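/- **Lemma 3.2 (Cell problem).** Let $m\ge 0$, $n\ge 2$, let $\psi:\mathbb Z^m\times S^{n-1}\to[0,\infty)$ be Borel measurable with $\psi(0,\cdot)=0$ and $\psi(b,t)\ge c_0|b|$ for some $c_0>0$ ($|\cdot|$ the Euclidean norm). Let $B_{1/2}\subset\mathbb R^n$ be the open ball of radius $1/2$ centred at $0$, and let $\mathcal M_{BC}(B_{1/2})$ be the set of divergence-free $\mathbb R^{m\times n}$-valued measures on $B_{1/2}$ of the form $\mu=\theta\otimes\tau\,\mathcal H^1\llcorner\gamma$, where $\gamma\subset B_{1/2}$ is $1$-rectifiable, $\tau:\gamma\to S^{n-1}$ is its tangent, and $\theta:\gamma\to\mathbb Z^m$ is $\mathcal H^1$-integrable; divergence free means $\int\sum_j\partial_j\varphi\,d\mu_{ij}=0$ for all $\varphi\in C_c^\infty(B_{1/2})$ and $i=1,\dots,m$. We say that $\mu$ has boundary values $(b,t)$ if $\mu=b\otimes t\,\mathcal H^1\llcorner\mathbb Rt$ on $B_{1/2}\setminus B'$ for some closed ball $B'\subset B_{1/2}$. For $b\in\mathbb Z^m$, $t\in S^{n-1}$ the $\mathcal H^1$-elliptic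 envelope is $$\bar\psi(b,t)=\inf\Big\{\int_\gamma\psi(\theta,\tau)\,d\mathcal H^1:\ \mu=\theta\otimes\tau\,\mathcal H^1\llcorner\gamma\in\mathcal M_{BC}(B_{1/2})\text{ with boundary values }(b,t)\Big\},$$ the infimum being taken over all such $\mu$ and all their representations $(\gamma,\theta,\tau)$. Then $\bar\psi$ is finite, and: 1. Let $\mu=\sum_{i=1}^N b_i\otimes t_i\,\mathcal H^1\llcorner\gamma_i\in\mathcal M_{BC}(B_{1/2})$ be polyhedral, with $b_i\in\mathbb Z^m$ and $\gamma_i\subset B_{1/2}$ nondegenerate segments (taken without endpoints) of direction $t_i\in S^{n-1}$ that are pairwise disjoint, and let $\mu$ have boundary values $(b,t)$. Then $$\bar\psi(b,t)\le\sum_{i=1}^N\mathcal H^1(\gamma_i)\,\bar\psi(b_i,t_i)=\bar E(\mu,B_{1/2}),$$ where $\bar E(\mu,B_{1/2})=\int_\gamma\bar\psi(\theta,\tau)\,d\mathcal H^1$ for any representation $\mu=\theta\otimes\tau\,\mathcal H^1\llcorner\gamma$ as above. 2. For each $b$, the function $t\mapsto|t|\,\bar\psi(b,t/|t|)$ (with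 value $0$ at $t=0$) is convex on $\mathbb R^n$. In particular, $\bar\psi$ is continuous. 3. $\bar\psi(b+b',t)\le\bar\psi(b,t)+\bar\psi(b',t)$ for all $b,b'\in\mathbb Z^m$, $t\in S^{n-1}$. Moreover, there is a constant $c>0$ depending only on $\psi$ such that 4. $\frac1c|b|\le\bar\psi(b,t)\le c|b|$ for all $b\in\mathbb Z^m$, $t\in S^{n-1}$; 5. $|\bar\psi(b,t)-\bar\psi(b',t')|\le c|b-b'|+c|b|\,|t-t'|$ for all $b,b'\in\mathbb Z^m$, $t,t'\in S^{n-1}$. -/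

import Mathlib

open Set MeasureTheory
open scoped NNReal ENNReal

noncomputable section

/-- `ℝⁿ` with the Euclidean norm. -/
abbrev Space (n : ℕ) : Type := EuclideanSpace ℝ (Fin n)

/-- The unit sphere `S^{n-1}` of `ℝⁿ`. -/
abbrev UnitSphere (n : ℕ) : Type := Metric.sphere (0 : Space n) 1

/-- The lattice `ℤᵐ`. -/
abbrev IntLattice (m : ℕ) : Type := Fin m → ℤ

/-- The Euclidean norm `|b|` of a lattice vector. -/
def latticeNorm {m : ℕ} (b : IntLattice m) : ℝ := Real.sqrt (∑ i, (b i : ℝ) ^ 2)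

/-- The `m × n` matrix `b ⊗ t`, given by its rows `b_i t ∈ ℝⁿ`. -/
def tensor {m n : ℕ} (b : IntLattice m) (t : Space n) : Fin m → Space n :=
  fun i => (b i : ℝ) • t

/-- `γ` is (countably) `1`-rectifiable: countably many Lipschitz curves cover it
up to an `ℋ¹`-null set. -/
def IsRectifiable {n : ℕ} (γ : Set (Space n)) : Prop :=
  ∃ c : ℕ → ℝ → Space n, (∀ k, ∃ K : ℝ≥0, LipschitzWith K (c k)) ∧
    Measure.hausdorffMeasure 1 (γ \ ⋃ k, range (c k)) = 0

/-- The unit field `τ` is tangent to `γ`: each Lipschitz curve `c` has, at almost all of the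
times that it spends in `γ`, its velocity in the line `ℝ τ`.  On a rectifiable set (which is covered
by Lipschitz curves, and in which the points reached with zero velocity or at a null set of times
are `ℋ¹`-null) this determines `± τ` at `ℋ¹`-almost every point, and `ℝ τ` is the
approximate tangent line. -/
def IsTangentTo {n : ℕ} (τ : Space n → UnitSphere n) (γ : Set (Space n)) : Prop :=
  ∀ c : ℝ → Space n, (∃ K : ℝ≥0, LipschitzWith K c) →
    ∀ᵐ s : ℝ, c s ∈ γ → deriv c s ∈ Submodule.span ℝ {(τ (c s) : Space n)}

/-- A triple `(γ, θ, τ)` representing a rectifiable `ℤᵐ`-valued `1`-current in `Ω`: `γ ⊆ Ω` is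
`1`-rectifiable, `τ` is its tangent, and the multiplicity `θ` is `ℋ¹`-integrable on `γ`.
The values of `θ` and `τ` outside `γ` are irrelevant. -/
structure RectRep (m n : ℕ) (Ω : Set (Space n)) where
  carrier : Set (Space n)
  mult : Space n → IntLattice m
  tangent : Space n → UnitSphere n
  measurableSet_carrier : MeasurableSet carrier
  carrier_subset : carrier ⊆ Ω
  rectifiable : IsRectifiable carrier
  measurable_mult : Measurable mult
  measurable_tangent : Measurable tangent
  isTangentTo : IsTangentTo tangent carrier
  integrable : IntegrableOn (fun x => latticeNorm (mult x)) carrier (Measure.hausdorffMeasure 1)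

namespace RectRep

variable {m n : ℕ} {Ω : Set (Space n)}

/-- The `ℝ^{m×n}`-valued measure `θ ⊗ τ ℋ¹ ⌞ γ`. -/
def toMeasure (T : RectRep m n Ω) : VectorMeasure (Space n) (Fin m → Space n) :=
  ((Measure.hausdorffMeasure 1).restrict T.carrier).withDensityᵥ
    (fun x => tensor (T.mult x) (T.tangent x : Space n))

/-- `μ = θ ⊗ τ ℋ¹ ⌞ γ` is divergence free in `Ω`: each row `i` satisfies
`∫ ∑ⱼ ∂ⱼφ dμᵢⱼ = ∫_γ θᵢ Dφ·τ dℋ¹ = 0` for all `φ ∈ C_c^∞(Ω)`. -/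
def DivFree (T : RectRep m n Ω) : Prop :=
  ∀ φ : Space n → ℝ, ContDiff ℝ (⊤ : ℕ∞) φ → HasCompactSupport φ → tsupport φ ⊆ Ω →
    ∀ i : Fin m, ∫ x in T.carrier, (T.mult x i : ℝ) * fderiv ℝ φ x (T.tangent x : Space n)
      ∂(Measure.hausdorffMeasure 1) = 0

/-- The line energy `∫_γ f(θ, τ) dℋ¹ ∈ [0, ∞]`. -/
def energy (f : IntLattice m → UnitSphere n → ℝ≥0∞) (T : RectRep m n Ω) : ℝ≥0∞ :=
  ∫⁻ x in T.carrier, f (T.mult x) (T.tangent x) ∂(Measure.hausdorffMeasure 1)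

end RectRep

/-- The open ball `B_{1/2}` of radius `1/2` centred at the origin. -/
abbrev halfBall (n : ℕ) : Set (Space n) := Metric.ball 0 (1 / 2)

/-- The measure `b ⊗ t ℋ¹ ⌞ (ℝt ∩ B_{1/2})`. -/
def lineMeasure {m n : ℕ} (b : IntLattice m) (t : UnitSphere n) :
    VectorMeasure (Space n) (Fin m → Space n) :=
  ((Measure.hausdorffMeasure 1).restrict
    ((Submodule.span ℝ {(t : Space n)} : Set (Space n)) ∩ halfBall n)).withDensityᵥ
      (fun _ => tensor b (t : Space n))

/-- `supp (μ - b ⊗ t ℋ¹ ⌞ (ℝt ∩ B_{1/2})) ⊂ B_{1/2}`: outside a smaller concentric closed ball,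
the measure `μ` on `B_{1/2}` coincides with `b ⊗ t ℋ¹ ⌞ ℝt`. -/
def HasLineBoundary {m n : ℕ} (μ : VectorMeasure (Space n) (Fin m → Space n))
    (b : IntLattice m) (t : UnitSphere n) : Prop :=
  ∃ r : ℝ, r < 1 / 2 ∧ ∀ A : Set (Space n), MeasurableSet A →
    A ⊆ halfBall n \ Metric.closedBall 0 r → μ A = lineMeasure b t A

/-- The `ℋ¹`-elliptic envelope `ψ̄(b, t)` of `ψ`, with values in `[0, ∞]`: the infimum of
`∫_γ ψ(θ, τ) dℋ¹` over all divergence-free `μ = θ ⊗ τ ℋ¹ ⌞ γ` in `B_{1/2}` with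
`supp (μ - b ⊗ t ℋ¹ ⌞ (ℝt ∩ B_{1/2})) ⊂ B_{1/2}`. -/
def ellipticEnvelope {m n : ℕ} (ψ : IntLattice m → UnitSphere n → ℝ≥0)
    (b : IntLattice m) (t : UnitSphere n) : ℝ≥0∞ :=
  ⨅ (T : RectRep m n (halfBall n)) (_ : T.DivFree) (_ : HasLineBoundary T.toMeasure b t),
    T.energy (fun b' t' => (ψ b' t' : ℝ≥0∞))

/-- The measure `∑ᵢ bᵢ ⊗ tᵢ ℋ¹ ⌞ γᵢ`, where `γᵢ` is the segment from `pᵢ` to `qᵢ`, taken without its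
(`ℋ¹`-null) endpoints. -/
def polyMeasure {m n N : ℕ} (p q : Fin N → Space n) (b : Fin N → IntLattice m)
    (t : Fin N → UnitSphere n) : VectorMeasure (Space n) (Fin m → Space n) :=
  ∑ i, ((Measure.hausdorffMeasure 1).restrict (openSegment ℝ (p i) (q i))).withDensityᵥ
    (fun _ => tensor (b i) (t i : Space n))

/-- The one-homogeneous function `x ↦ |x| F(x/|x|)` on `ℝⁿ`, equal to `0` at `x = 0`. -/
def homExt {n : ℕ} (F : UnitSphere n → ℝ) (x : Space n) : ℝ :=
  if h : x = 0 then 0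
  else ‖x‖ * F ⟨‖x‖⁻¹ • x, by simp [norm_smul, inv_mul_cancel₀ (norm_ne_zero_iff.mpr h)]⟩

end

/-! Everything rests on one surgery. If `T` competes for the boundary values `(b, t)`, then `T`
minus the straight line acts as zero on gradients of all smooth functions, not only of compactly
supported ones (`integral_fderiv_dens_sub_lineDens`, by a cutoff). Hence, in any ball where a
divergence-free measure is a diameter with multiplicity `b` and direction `t`, a scaled copy of `T`
may replace it without creating divergence (`exists_replace_ball`).

For a polyhedral measure, a Besicovitch covering gives finitely many disjoint balls of this kind
that exhaust its segments up to length `ε` (`exists_finset_balls`). Inserting almost optimal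
competitors lowers the cost per unit length from `ψ` to almost `ψ̄`, while the uncovered part costs
`O(ε)`; this is `ellipticEnvelope_le_sum`. The relaxed energy does not depend on the representation,
since a rank-one matrix determines its factors up to a common sign and `ψ̄` is even under that sign
change.

The remaining upper bounds use one polygonal network, a line with a triangular detour
(`envelope_detour_le`). With no multiplicity on the base it gives subadditivity in the direction,
hence convexity; with multiplicity `b` on the base and a detour `b'` of vanishing height it gives
subadditivity in the multiplicity. Expanding `t` and `b` in coordinates yields linear growth, and
subadditivity with growth yields the Lipschitz bound. The lower bound is a calibration: testing with
`⟨t, ·⟩` shows that the mass is at least `|b|` (`latticeNorm_le_integral`). -/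

/-! ### The lattice norm and the matrices `b ⊗ t`. -/

section Lattice
variable {m n : ℕ}

theorem latticeNorm_nonneg (b : IntLattice m) : 0 ≤ latticeNorm b := Real.sqrt_nonneg _

theorem abs_le_latticeNorm (b : IntLattice m) (i : Fin m) : |(b i : ℝ)| ≤ latticeNorm b := by
  unfold latticeNorm
  apply Real.le_sqrt_of_sq_le
  rw [sq_abs]
  exact Finset.single_le_sum (f := fun i => (b i : ℝ) ^ 2) (fun j _ => sq_nonneg _)
    (Finset.mem_univ i)

@[simp] theorem latticeNorm_zero : latticeNorm (0 : IntLattice m) = 0 := by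
  simp [latticeNorm]

theorem latticeNorm_sq (b : IntLattice m) : latticeNorm b ^ 2 = ∑ i, (b i : ℝ) ^ 2 :=
  Real.sq_sqrt (Finset.sum_nonneg fun _ _ => sq_nonneg _)

theorem measurable_intCast_apply (i : Fin m) : Measurable fun b : IntLattice m => (b i : ℝ) :=
  (measurable_from_top (f := fun z : ℤ => (z : ℝ))).comp (measurable_pi_apply i)

@[simp] theorem tensor_apply (b : IntLattice m) (t : Space n) (i : Fin m) :
    tensor b t i = (b i : ℝ) • t := rfl

@[simp] theorem tensor_zero_left (t : Space n) : tensor (0 : IntLattice m) t = 0 := by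
  ext i; simp

theorem norm_coe_sphere (t : UnitSphere n) : ‖(t : Space n)‖ = 1 := by
  simp

theorem norm_tensor_le (b : IntLattice m) (t : UnitSphere n) :
    ‖tensor b (t : Space n)‖ ≤ latticeNorm b := by
  rw [pi_norm_le_iff_of_nonneg (latticeNorm_nonneg b)]
  intro i
  rw [tensor_apply, norm_smul, norm_coe_sphere, mul_one]
  exact abs_le_latticeNorm b i

theorem tensor_neg_neg (b : IntLattice m) (t : Space n) : tensor (-b) (-t) = tensor b t := by
  ext i; simp

end Lattice

/-! ### Densities with respect to `ℋ¹`. -/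

namespace RectRep
variable {m n : ℕ} {Ω : Set (Space n)}

/-- The density of `θ ⊗ τ ℋ¹ ⌞ γ` with respect to `ℋ¹`. -/
noncomputable def dens (T : RectRep m n Ω) : Space n → Fin m → Space n :=
  T.carrier.indicator fun x => tensor (T.mult x) (T.tangent x : Space n)

theorem dens_of_mem (T : RectRep m n Ω) {x : Space n} (hx : x ∈ T.carrier) :
    T.dens x = tensor (T.mult x) (T.tangent x : Space n) := indicator_of_mem hx _

theorem dens_of_notMem (T : RectRep m n Ω) {x : Space n} (hx : x ∉ T.carrier) :
    T.dens x = 0 := indicator_of_notMem hx _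

theorem dens_of_notMem_domain (T : RectRep m n Ω) {x : Space n} (hx : x ∉ Ω) :
    T.dens x = 0 := T.dens_of_notMem fun h => hx (T.carrier_subset h)

theorem measurable_tensor (T : RectRep m n Ω) :
    Measurable fun x => tensor (T.mult x) (T.tangent x : Space n) := by
  refine measurable_pi_lambda _ fun i => ?_
  exact ((measurable_intCast_apply i).comp T.measurable_mult).smul
    (measurable_subtype_coe.comp T.measurable_tangent)

theorem integrableOn_tensor (T : RectRep m n Ω) :
    IntegrableOn (fun x => tensor (T.mult x) (T.tangent x : Space n)) T.carrier μH[1] :=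
  T.integrable.mono' T.measurable_tensor.aestronglyMeasurable
    (ae_of_all _ fun _ => norm_tensor_le _ _)

theorem integrable_dens (T : RectRep m n Ω) : Integrable T.dens μH[1] :=
  (integrable_indicator_iff T.measurableSet_carrier).2 T.integrableOn_tensor

theorem toMeasure_apply (T : RectRep m n Ω) {A : Set (Space n)} (hA : MeasurableSet A) :
    T.toMeasure A = ∫ x in A, T.dens x ∂μH[1] := by
  rw [toMeasure, withDensityᵥ_apply T.integrableOn_tensor hA, dens,
    setIntegral_indicator T.measurableSet_carrier, Measure.restrict_restrict hA]

/-- Integrable densities are unique almost everywhere, even though `ℋ¹` need not be σ-finite. The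
localisation to `S` is needed because boundary values are prescribed only near the sphere. -/
theorem dens_ae_eq_of_toMeasure_eq {f : Space n → Fin m → Space n} (T : RectRep m n Ω)
    (hf : Integrable f μH[1]) {S : Set (Space n)} (hS : MeasurableSet S)
    (h : ∀ A ⊆ S, MeasurableSet A → T.toMeasure A = ∫ x in A, f x ∂μH[1]) :
    ∀ᵐ x ∂μH[1], x ∈ S → T.dens x = f x := by
  rw [← ae_restrict_iff' hS]
  refine T.integrable_dens.restrict.ae_eq_of_forall_setIntegral_eq _ _ hf.restrict ?_
  intro A hA _
  rw [Measure.restrict_restrict hA, ← h _ inter_subset_right (hA.inter hS),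
    T.toMeasure_apply (hA.inter hS)]

/-- In this form the condition is linear in the density and insensitive to null sets, so
representations can be compared, cut and glued through their densities alone. -/
theorem divFree_iff (T : RectRep m n Ω) : T.DivFree ↔
    ∀ φ : Space n → ℝ, ContDiff ℝ (⊤ : ℕ∞) φ → HasCompactSupport φ → tsupport φ ⊆ Ω →
      ∀ i : Fin m, ∫ x, fderiv ℝ φ x (T.dens x i) ∂μH[1] = 0 := by
  have key : ∀ (φ : Space n → ℝ) (i : Fin m),
      ∫ x in T.carrier, (T.mult x i : ℝ) * fderiv ℝ φ x (T.tangent x : Space n) ∂μH[1] =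
      ∫ x, fderiv ℝ φ x (T.dens x i) ∂μH[1] := by
    intro φ i
    rw [← integral_indicator T.measurableSet_carrier]
    congr 1
    ext x
    by_cases hx : x ∈ T.carrier
    · simp [hx, T.dens_of_mem hx]
    · simp [hx, T.dens_of_notMem hx]
  simp only [DivFree, key]

end RectRep

theorem integrable_clm_apply {m n : ℕ} {g : Space n → Space n →L[ℝ] ℝ} (hg : Continuous g)
    {C : ℝ} (hC : ∀ x, ‖g x‖ ≤ C) {D : Space n → Fin m → Space n} (hD : Integrable D μH[1])
    (i : Fin m) : Integrable (fun x => g x (D x i)) μH[1] := by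
  have hDi : Integrable (fun x => D x i) μH[1] := hD.eval i
  refine (hDi.norm.const_mul C).mono' ?_ (ae_of_all _ fun x => ?_)
  · have : Continuous fun z : (Space n →L[ℝ] ℝ) × Space n => z.1 z.2 := by fun_prop
    exact this.comp_aestronglyMeasurable
      (hg.aestronglyMeasurable.prodMk hDi.aestronglyMeasurable)
  · exact ((g x).le_opNorm _).trans (by gcongr; exact hC x)

theorem integrable_fderiv_apply {m n : ℕ} {φ : Space n → ℝ} (hφ : ContDiff ℝ (⊤ : ℕ∞) φ)
    (hc : HasCompactSupport φ) {D : Space n → Fin m → Space n} (hD : Integrable D μH[1])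
    (i : Fin m) : Integrable (fun x => fderiv ℝ φ x (D x i)) μH[1] := by
  have hcont : Continuous (fderiv ℝ φ) := hφ.continuous_fderiv (by simp)
  obtain ⟨C, hC⟩ := (hc.fderiv (𝕜 := ℝ)).exists_bound_of_continuous hcont
  exact integrable_clm_apply hcont hC hD i

/-! ### Segments and diameters. -/

section Line
variable {m n : ℕ}

theorem isometry_line (p : Space n) (t : UnitSphere n) :
    Isometry fun s : ℝ => p + s • (t : Space n) := by
  refine Isometry.of_dist_eq fun x y => ?_
  rw [dist_add_left, dist_eq_norm, ← sub_smul, norm_smul, norm_coe_sphere, mul_one,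
    Real.dist_eq, Real.norm_eq_abs]

/-- The unit-speed parametrisation is an isometry, and `ℋ¹` on the real line is Lebesgue measure. -/
theorem hausdorff_restrict_eq_map_line (p : Space n) (t : UnitSphere n) {S : Set (Space n)}
    (hS : MeasurableSet S) (hr : S ⊆ range fun s : ℝ => p + s • (t : Space n)) :
    (μH[1] : Measure (Space n)).restrict S =
      ((volume : Measure ℝ).restrict ((fun s : ℝ => p + s • (t : Space n)) ⁻¹' S)).map
        fun s : ℝ => p + s • (t : Space n) := by
  have hf := isometry_line p t
  have h1 := hf.map_hausdorffMeasure (d := 1) (Or.inl zero_le_one)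
  rw [hausdorffMeasure_real] at h1
  rw [← Measure.restrict_map hf.continuous.measurable hS, h1, Measure.restrict_restrict hS,
    inter_eq_left.2 hr]

theorem openSegment_eq_image_line {p q : Space n} {t : UnitSphere n} (hpq : p ≠ q)
    (h : q - p = ‖q - p‖ • (t : Space n)) :
    openSegment ℝ p q = (fun s : ℝ => p + s • (t : Space n)) '' Ioo 0 ‖q - p‖ := by
  have hl : 0 < ‖q - p‖ := norm_pos_iff.2 (sub_ne_zero.2 hpq.symm)
  rw [openSegment_eq_image']
  ext x
  constructor
  · rintro ⟨θ, hθ, rfl⟩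
    refine ⟨θ * ‖q - p‖, ⟨mul_pos hθ.1 hl, ?_⟩, ?_⟩
    · nlinarith [hθ.2]
    · simp only [mul_smul, ← h]
  · rintro ⟨s, hs, rfl⟩
    refine ⟨s / ‖q - p‖, ⟨div_pos hs.1 hl, (div_lt_one hl).2 hs.2⟩, ?_⟩
    simp only
    rw [h, smul_smul]
    congr 2
    rw [norm_smul, norm_coe_sphere, mul_one, norm_norm]
    field_simp

theorem measurableSet_openSegment {p q : Space n} {t : UnitSphere n} (hpq : p ≠ q)
    (h : q - p = ‖q - p‖ • (t : Space n)) : MeasurableSet (openSegment ℝ p q) := by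
  rw [openSegment_eq_image_line hpq h]
  exact (isometry_line p t).isClosedEmbedding.measurableEmbedding.measurableSet_image.2
    measurableSet_Ioo

theorem hausdorff_restrict_openSegment {p q : Space n} {t : UnitSphere n} (hpq : p ≠ q)
    (h : q - p = ‖q - p‖ • (t : Space n)) :
    (μH[1] : Measure (Space n)).restrict (openSegment ℝ p q) =
      ((volume : Measure ℝ).restrict (Ioo 0 ‖q - p‖)).map fun s : ℝ => p + s • (t : Space n) := by
  rw [hausdorff_restrict_eq_map_line p t (measurableSet_openSegment hpq h)]
  · rw [openSegment_eq_image_line hpq h, preimage_image_eq _ (isometry_line p t).injective]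
  · rw [openSegment_eq_image_line hpq h]
    exact image_subset_range _ _

theorem hausdorff_openSegment {p q : Space n} {t : UnitSphere n} (hpq : p ≠ q)
    (h : q - p = ‖q - p‖ • (t : Space n)) :
    (μH[1] : Measure (Space n)) (openSegment ℝ p q) = ENNReal.ofReal ‖q - p‖ := by
  have h1 := congrArg (fun μ => μ univ) (hausdorff_restrict_openSegment hpq h)
  simpa [Measure.map_apply (isometry_line p t).continuous.measurable MeasurableSet.univ] using h1

/-- The fundamental theorem of calculus along the segment. It turns divergence freeness of a
polyhedral measure into a balance of multiplicities at the vertices. -/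
theorem setIntegral_fderiv_openSegment {p q : Space n} {t : UnitSphere n} (hpq : p ≠ q)
    (h : q - p = ‖q - p‖ • (t : Space n)) {φ : Space n → ℝ} (hφ : ContDiff ℝ (⊤ : ℕ∞) φ) :
    ∫ x in openSegment ℝ p q, fderiv ℝ φ x (t : Space n) ∂μH[1] = φ q - φ p := by
  rw [hausdorff_restrict_openSegment hpq h,
    (isometry_line p t).isClosedEmbedding.measurableEmbedding.integral_map,
    ← integral_Ioc_eq_integral_Ioo, ← intervalIntegral.integral_of_le (norm_nonneg _)]
  have hder : ∀ s : ℝ, HasDerivAt (fun s : ℝ => φ (p + s • (t : Space n)))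
      (fderiv ℝ φ (p + s • (t : Space n)) (t : Space n)) s := by
    intro s
    have h1 : HasDerivAt (fun s : ℝ => p + s • (t : Space n)) (t : Space n) s := by
      simpa using ((hasDerivAt_id s).smul_const (t : Space n)).const_add p
    exact ((hφ.differentiable (by simp)) _).hasFDerivAt.comp_hasDerivAt s h1
  rw [intervalIntegral.integral_eq_sub_of_hasDerivAt fun s _ => hder s]
  · simp only [← h, zero_smul, add_zero, add_sub_cancel]
  · apply Continuous.intervalIntegrable
    have : Continuous (fderiv ℝ φ) := hφ.continuous_fderiv (by simp)
    fun_prop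

/-- All but countably many times in `c ⁻¹' γ` are limits from the right of other such times. There
the velocity, if it exists, is a limit of difference quotients lying in the closed line `ℝ t`. -/
theorem isTangentTo_of_subset_line {γ : Set (Space n)} {p : Space n} {t : UnitSphere n}
    (hγ : γ ⊆ range fun s : ℝ => p + s • (t : Space n)) {τ : Space n → UnitSphere n}
    (hτ : ∀ x ∈ γ, τ x = t) : IsTangentTo τ γ := by
  intro c _
  set S := c ⁻¹' γ with hS
  have hcount := countable_setOfPred_isolated_right_within (s := S)
  have hae := hcount.ae_notMem (volume : Measure ℝ)
  filter_upwards [hae] with s hs hsγ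
  rw [hτ _ hsγ]
  by_cases hd : DifferentiableAt ℝ c s
  swap
  -- The default value `0` of `deriv` lies in every subspace.
  · rw [deriv_zero_of_not_differentiableAt hd]; exact zero_mem _
  have hsS : s ∈ S := hsγ
  have hacc : AccPt s (Filter.principal S) := by
    have hne : (nhdsWithin s (S ∩ Ioi s)).NeBot := ⟨fun h => hs ⟨hsS, h⟩⟩
    refine hne.mono (le_inf (nhdsWithin_mono _ ?_) (inf_le_right.trans ?_))
    · exact fun x hx => ne_of_gt hx.2
    · exact Filter.principal_mono.2 inter_subset_left
  have huniq : UniqueDiffWithinAt ℝ S s := uniqueDiffWithinAt_iff_accPt.2 hacc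
  -- Subtracting `p` leaves the derivative unchanged and moves the values on `S` into the linear
  -- span of `t`.
  have h1 := range_derivWithin_subset_closure_span_image (𝕜 := ℝ) (fun s => c s - p) (s := S)
    (t := S) (by rw [inter_self]; exact subset_closure)
  have h2 : derivWithin (fun s => c s - p) S s = deriv c s := by
    rw [derivWithin_sub_const, hd.derivWithin huniq]
  have h3 := h1 ⟨s, h2⟩
  have hle : Submodule.span ℝ ((fun s => c s - p) '' S) ≤ Submodule.span ℝ {(t : Space n)} := by
    rw [Submodule.span_le]
    rintro _ ⟨u, hu, rfl⟩
    obtain ⟨v, hv⟩ := hγ hu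
    simp only at hv ⊢
    rw [← hv, add_sub_cancel_left]
    exact Submodule.smul_mem _ _ (Submodule.mem_span_singleton_self _)
  have hcl : IsClosed (Submodule.span ℝ {(t : Space n)} : Set (Space n)) :=
    Submodule.closed_of_finiteDimensional _
  exact closure_minimal hle hcl h3

theorem isRectifiable_of_subset_line {γ : Set (Space n)} {p : Space n} {t : UnitSphere n}
    (hγ : γ ⊆ range fun s : ℝ => p + s • (t : Space n)) : IsRectifiable γ := by
  refine ⟨fun _ s => p + s • (t : Space n), fun _ => ⟨1, (isometry_line p t).lipschitz⟩, ?_⟩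
  rw [sdiff_eq_empty.2, measure_empty]
  rwa [iUnion_const]

/-- The open diameter of `B_{1/2}` in direction `t`. -/
def diameter (t : UnitSphere n) : Set (Space n) :=
  openSegment ℝ (-(1 / 2 : ℝ) • (t : Space n)) ((1 / 2 : ℝ) • (t : Space n))

theorem diameter_sub (t : UnitSphere n) :
    (1 / 2 : ℝ) • (t : Space n) - (-(1 / 2 : ℝ) • (t : Space n)) = t := by
  rw [← sub_smul]; norm_num

theorem diameter_dir (t : UnitSphere n) :
    (1 / 2 : ℝ) • (t : Space n) - (-(1 / 2 : ℝ) • (t : Space n)) =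
      ‖(1 / 2 : ℝ) • (t : Space n) - (-(1 / 2 : ℝ) • (t : Space n))‖ • (t : Space n) := by
  rw [diameter_sub, norm_coe_sphere, one_smul]

theorem diameter_ne (t : UnitSphere n) :
    (-(1 / 2 : ℝ) • (t : Space n)) ≠ ((1 / 2 : ℝ) • (t : Space n)) := by
  intro h
  have h1 := diameter_sub t
  rw [h, sub_self] at h1
  have := norm_coe_sphere t
  rw [← h1] at this
  simp at this

theorem mem_diameter {t : UnitSphere n} {x : Space n} :
    x ∈ diameter t ↔ ∃ s : ℝ, |s| < 1 / 2 ∧ x = s • (t : Space n) := by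
  rw [diameter, openSegment_eq_image_line (diameter_ne t) (diameter_dir t), diameter_sub,
    norm_coe_sphere]
  constructor
  · rintro ⟨s, hs, rfl⟩
    refine ⟨s - 1 / 2, abs_lt.2 ⟨by linarith [hs.1], by linarith [hs.2]⟩, ?_⟩
    simp only [← add_smul]
    congr 1; ring
  · rintro ⟨s, hs, rfl⟩
    rw [abs_lt] at hs
    refine ⟨s + 1 / 2, ⟨by linarith [hs.1], by linarith [hs.2]⟩, ?_⟩
    simp only [← add_smul]
    congr 1; ring

theorem span_inter_halfBall (t : UnitSphere n) :
    (Submodule.span ℝ {(t : Space n)} : Set (Space n)) ∩ halfBall n = diameter t := by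
  ext x
  rw [mem_diameter]
  simp only [mem_inter_iff, SetLike.mem_coe, Submodule.mem_span_singleton, mem_ball_zero_iff]
  constructor
  · rintro ⟨⟨s, rfl⟩, h⟩
    rw [norm_smul, norm_coe_sphere, mul_one, Real.norm_eq_abs] at h
    exact ⟨s, h, rfl⟩
  · rintro ⟨s, h, rfl⟩
    rw [norm_smul, norm_coe_sphere, mul_one, Real.norm_eq_abs]
    exact ⟨⟨s, rfl⟩, h⟩

theorem diameter_subset_halfBall (t : UnitSphere n) : diameter t ⊆ halfBall n := by
  rw [← span_inter_halfBall]; exact inter_subset_right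

theorem measurableSet_diameter (t : UnitSphere n) : MeasurableSet (diameter t) :=
  measurableSet_openSegment (diameter_ne t) (diameter_dir t)

theorem hausdorff_diameter (t : UnitSphere n) :
    (μH[1] : Measure (Space n)) (diameter t) = 1 := by
  rw [diameter, hausdorff_openSegment (diameter_ne t) (diameter_dir t), diameter_sub,
    norm_coe_sphere, ENNReal.ofReal_one]

/-- The density of `lineMeasure b t` with respect to `ℋ¹`. -/
noncomputable def lineDens (b : IntLattice m) (t : UnitSphere n) : Space n → Fin m → Space n :=
  (diameter t).indicator fun _ => tensor b (t : Space n)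

theorem integrable_lineDens (b : IntLattice m) (t : UnitSphere n) :
    Integrable (lineDens b t) μH[1] := by
  refine (integrable_indicator_iff (measurableSet_diameter t)).2 (integrableOn_const ?_)
  simp [hausdorff_diameter]

theorem lineMeasure_apply (b : IntLattice m) (t : UnitSphere n) {A : Set (Space n)}
    (hA : MeasurableSet A) : lineMeasure b t A = ∫ x in A, lineDens b t x ∂μH[1] := by
  have hi := (integrable_indicator_iff (measurableSet_diameter t)).1 (integrable_lineDens b t)
  rw [lineMeasure, span_inter_halfBall, withDensityᵥ_apply hi hA, lineDens,
    setIntegral_indicator (measurableSet_diameter t), Measure.restrict_restrict hA]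

/-- Reversing both factors changes neither the matrix nor the diameter; this is the source of the
evenness of `ψ̄`. -/
theorem lineDens_neg_neg (b : IntLattice m) (t : UnitSphere n) :
    lineDens (-b) (-t) = lineDens b t := by
  ext1 x
  have : diameter (-t) = diameter t := by
    ext x
    simp only [mem_diameter]
    constructor <;>
    · rintro ⟨s, h, rfl⟩
      exact ⟨-s, by rwa [abs_neg], by simp⟩
  unfold lineDens
  rw [this]
  by_cases hx : x ∈ diameter t
  · simp only [indicator_of_mem hx]
    exact tensor_neg_neg b _
  · simp [hx]

theorem apply_smul_sphere_eq_zero {φ : Space n → ℝ} (hs : tsupport φ ⊆ halfBall n)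
    (t : UnitSphere n) {s : ℝ} (hst : |s| = 1 / 2) : φ (s • (t : Space n)) = 0 := by
  refine image_eq_zero_of_notMem_tsupport fun h => ?_
  have := mem_ball_zero_iff.1 (hs h)
  rw [norm_smul, norm_coe_sphere, mul_one, Real.norm_eq_abs, hst] at this
  exact lt_irrefl _ this

/-- The endpoint values are kept, so that linear test functions are allowed; for test functions
supported in the ball they vanish. -/
theorem integral_fderiv_lineDens (b : IntLattice m) (t : UnitSphere n) {φ : Space n → ℝ}
    (hφ : ContDiff ℝ (⊤ : ℕ∞) φ) (i : Fin m) :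
    ∫ x, fderiv ℝ φ x (lineDens b t x i) ∂μH[1] =
      (b i : ℝ) * (φ ((1 / 2 : ℝ) • (t : Space n)) - φ (-(1 / 2 : ℝ) • (t : Space n))) := by
  rw [← setIntegral_fderiv_openSegment (diameter_ne t) (diameter_dir t) hφ,
    ← integral_const_mul, ← diameter, ← integral_indicator (measurableSet_diameter t)]
  congr 1
  ext x
  by_cases hx : x ∈ diameter t <;> simp [lineDens, hx]

end Line

/-- Both densities vanish outside `B_{1/2}`, so agreement near the sphere extends to the whole
complement of the smaller ball. -/
theorem hasLineBoundary_toMeasure_iff {m n : ℕ} (T : RectRep m n (halfBall n))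
    (b : IntLattice m) (t : UnitSphere n) : HasLineBoundary T.toMeasure b t ↔
      ∃ r : ℝ, r < 1 / 2 ∧ ∀ᵐ x ∂μH[1], x ∉ Metric.closedBall 0 r → T.dens x = lineDens b t x := by
  refine exists_congr fun r => and_congr_right fun _ => ?_
  have hmeas : MeasurableSet (halfBall n \ Metric.closedBall 0 r) :=
    measurableSet_ball.diff measurableSet_closedBall
  constructor
  · intro h
    have := T.dens_ae_eq_of_toMeasure_eq (integrable_lineDens b t) hmeas
      fun A hA hAm => by rw [h A hAm hA, lineMeasure_apply b t hAm]
    filter_upwards [this] with x hx hxr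
    by_cases hxb : x ∈ halfBall n
    · exact hx ⟨hxb, hxr⟩
    · rw [T.dens_of_notMem_domain hxb, lineDens,
        indicator_of_notMem fun h => hxb (diameter_subset_halfBall t h)]
  · intro h A hA hAs
    rw [T.toMeasure_apply hA, lineMeasure_apply b t hA]
    refine setIntegral_congr_ae hA ?_
    filter_upwards [h] with x hx hxA using hx (hAs hxA).2

/-! ### Restricting and gluing representations. -/

theorem IsRectifiable.mono {n : ℕ} {γ γ' : Set (Space n)} (h : IsRectifiable γ) (hs : γ' ⊆ γ) :
    IsRectifiable γ' := by
  obtain ⟨c, hc, h0⟩ := h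
  exact ⟨c, hc, measure_mono_null (sdiff_subset_sdiff_left hs) h0⟩

theorem IsRectifiable.union {n : ℕ} {γ γ' : Set (Space n)} (h : IsRectifiable γ)
    (h' : IsRectifiable γ') : IsRectifiable (γ ∪ γ') := by
  obtain ⟨c, hc, h0⟩ := h
  obtain ⟨c', hc', h0'⟩ := h'
  refine ⟨fun k => Sum.elim c c' (Equiv.natSumNatEquivNat.symm k), fun k => ?_, ?_⟩
  · rcases h : Equiv.natSumNatEquivNat.symm k with j | j
    · simp only [h]; exact hc j
    · simp only [h]; exact hc' j
  · refine measure_mono_null ?_ (measure_union_null h0 h0')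
    rintro x ⟨hx, hxn⟩
    simp only [mem_iUnion, not_exists] at hxn
    rcases hx with hx | hx
    · refine Or.inl ⟨hx, ?_⟩
      simp only [mem_iUnion, not_exists]
      intro k
      simpa using hxn (Equiv.natSumNatEquivNat (Sum.inl k))
    · refine Or.inr ⟨hx, ?_⟩
      simp only [mem_iUnion, not_exists]
      intro k
      simpa using hxn (Equiv.natSumNatEquivNat (Sum.inr k))

namespace RectRep
variable {m n : ℕ} {Ω : Set (Space n)}

/-- The density of the line energy with respect to `ℋ¹`. -/
noncomputable def energyDens (f : IntLattice m → UnitSphere n → ℝ≥0∞) (T : RectRep m n Ω) :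
    Space n → ℝ≥0∞ :=
  T.carrier.indicator fun x => f (T.mult x) (T.tangent x)

theorem energy_eq_lintegral (f : IntLattice m → UnitSphere n → ℝ≥0∞) (T : RectRep m n Ω) :
    T.energy f = ∫⁻ x, T.energyDens f x ∂μH[1] := by
  rw [energy, energyDens, lintegral_indicator T.measurableSet_carrier]

/-- The part of a representation that lies in the measurable set `S`. -/
def restrict (T : RectRep m n Ω) {S : Set (Space n)} (hS : MeasurableSet S) : RectRep m n Ω where
  carrier := T.carrier ∩ S
  mult := T.mult
  tangent := T.tangent
  measurableSet_carrier := T.measurableSet_carrier.inter hS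
  carrier_subset := inter_subset_left.trans T.carrier_subset
  rectifiable := T.rectifiable.mono inter_subset_left
  measurable_mult := T.measurable_mult
  measurable_tangent := T.measurable_tangent
  isTangentTo := fun c hc => by
    filter_upwards [T.isTangentTo c hc] with s hs hsγ using hs hsγ.1
  integrable := T.integrable.mono_set inter_subset_left

theorem dens_restrict (T : RectRep m n Ω) {S : Set (Space n)} (hS : MeasurableSet S) :
    (T.restrict hS).dens = S.indicator T.dens := by
  rw [dens, dens, indicator_indicator, inter_comm]; rfl

theorem energyDens_restrict (f : IntLattice m → UnitSphere n → ℝ≥0∞) (T : RectRep m n Ω)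
    {S : Set (Space n)} (hS : MeasurableSet S) :
    (T.restrict hS).energyDens f = S.indicator (T.energyDens f) := by
  rw [energyDens, energyDens, indicator_indicator, inter_comm]; rfl

open Classical in
/-- The union of two representations with disjoint carriers. -/
noncomputable def union (T₁ T₂ : RectRep m n Ω) (hd : Disjoint T₁.carrier T₂.carrier) :
    RectRep m n Ω where
  carrier := T₁.carrier ∪ T₂.carrier
  mult := T₁.carrier.piecewise T₁.mult T₂.mult
  tangent := T₁.carrier.piecewise T₁.tangent T₂.tangent
  measurableSet_carrier := T₁.measurableSet_carrier.union T₂.measurableSet_carrier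
  carrier_subset := union_subset T₁.carrier_subset T₂.carrier_subset
  rectifiable := T₁.rectifiable.union T₂.rectifiable
  measurable_mult :=
    T₁.measurable_mult.piecewise T₁.measurableSet_carrier T₂.measurable_mult
  measurable_tangent :=
    T₁.measurable_tangent.piecewise T₁.measurableSet_carrier T₂.measurable_tangent
  isTangentTo := fun c hc => by
    filter_upwards [T₁.isTangentTo c hc, T₂.isTangentTo c hc] with s h₁ h₂ hs
    by_cases h : c s ∈ T₁.carrier
    · rw [piecewise_eq_of_mem _ _ _ h]; exact h₁ h
    · rw [piecewise_eq_of_notMem _ _ _ h]; exact h₂ (hs.resolve_left h)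
  integrable := by
    refine IntegrableOn.union ?_ ?_
    · refine T₁.integrable.congr_fun (fun x hx => ?_) T₁.measurableSet_carrier
      simp only [piecewise_eq_of_mem _ _ _ hx]
    · refine T₂.integrable.congr_fun (fun x hx => ?_) T₂.measurableSet_carrier
      simp only [piecewise_eq_of_notMem _ _ _ (hd.notMem_of_mem_right hx)]

theorem dens_union (T₁ T₂ : RectRep m n Ω) (hd : Disjoint T₁.carrier T₂.carrier) :
    (T₁.union T₂ hd).dens = T₁.dens + T₂.dens := by
  ext1 x
  rw [Pi.add_apply]
  by_cases h : x ∈ T₁.carrier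
  · rw [T₂.dens_of_notMem (hd.notMem_of_mem_left h), add_zero, T₁.dens_of_mem h,
      dens_of_mem _ (Or.inl h)]
    simp [union, h]
  · by_cases h' : x ∈ T₂.carrier
    · rw [T₁.dens_of_notMem h, zero_add, T₂.dens_of_mem h', dens_of_mem _ (Or.inr h')]
      simp [union, h]
    · rw [T₁.dens_of_notMem h, T₂.dens_of_notMem h', add_zero, dens_of_notMem]
      exact fun hx => hx.elim h h'

theorem energyDens_union (f : IntLattice m → UnitSphere n → ℝ≥0∞) (T₁ T₂ : RectRep m n Ω)
    (hd : Disjoint T₁.carrier T₂.carrier) :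
    (T₁.union T₂ hd).energyDens f = T₁.energyDens f + T₂.energyDens f := by
  ext1 x
  simp only [Pi.add_apply, energyDens]
  by_cases h : x ∈ T₁.carrier
  · simp [union, h, hd.notMem_of_mem_left h]
  · by_cases h' : x ∈ T₂.carrier <;> simp [union, h, h']

end RectRep

/-! ### Scaling competitors to small balls. -/

section Scaling
variable {m n : ℕ}

/-- The map `z ↦ ρ⁻¹ (z - x)`, which takes the ball `B(x, ρ/2)` to `B_{1/2}`. -/
noncomputable def blowUp (x : Space n) (ρ : ℝ) (z : Space n) : Space n := ρ⁻¹ • (z - x)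

/-- The inverse `y ↦ x + ρ y` of `blowUp`. -/
noncomputable def blowDown (x : Space n) (ρ : ℝ) (y : Space n) : Space n := x + ρ • y

theorem blowDown_blowUp (x : Space n) {ρ : ℝ} (hρ : 0 < ρ) (z : Space n) :
    blowDown x ρ (blowUp x ρ z) = z := by
  rw [blowDown, blowUp, smul_inv_smul₀ hρ.ne', add_sub_cancel]

theorem blowUp_blowDown (x : Space n) {ρ : ℝ} (hρ : 0 < ρ) (y : Space n) :
    blowUp x ρ (blowDown x ρ y) = y := by
  rw [blowDown, blowUp, add_sub_cancel_left, inv_smul_smul₀ hρ.ne']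

theorem continuous_blowUp (x : Space n) (ρ : ℝ) : Continuous (blowUp x ρ) := by
  unfold blowUp; fun_prop

theorem continuous_blowDown (x : Space n) (ρ : ℝ) : Continuous (blowDown x ρ) := by
  unfold blowDown; fun_prop

theorem blowUp_mem_halfBall (x : Space n) {ρ : ℝ} (hρ : 0 < ρ) (z : Space n) :
    blowUp x ρ z ∈ halfBall n ↔ z ∈ Metric.ball x (ρ / 2) := by
  rw [mem_ball_zero_iff, mem_ball_iff_norm, blowUp, norm_smul, norm_inv, Real.norm_eq_abs,
    abs_of_pos hρ, inv_mul_lt_iff₀ hρ]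
  ring_nf

theorem measurableEmbedding_blowUp (x : Space n) {ρ : ℝ} (hρ : 0 < ρ) :
    MeasurableEmbedding (blowUp x ρ) :=
  ((Homeomorph.mk ⟨blowUp x ρ, blowDown x ρ, blowDown_blowUp x hρ, blowUp_blowDown x hρ⟩
    (continuous_blowUp x ρ) (continuous_blowDown x ρ)) : Space n ≃ₜ Space n).measurableEmbedding

-- The preimage of `S` is a translate of `ρ • S`, and `ℋ¹` is translation invariant and homogeneous
-- of degree one.
open scoped Pointwise in
theorem map_blowUp_hausdorff (x : Space n) {ρ : ℝ} (hρ : 0 < ρ) :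
    (μH[1] : Measure (Space n)).map (blowUp x ρ) = ENNReal.ofReal ρ • μH[1] := by
  ext S hS
  rw [Measure.map_apply (continuous_blowUp x ρ).measurable hS, Measure.smul_apply]
  have h1 : blowUp x ρ ⁻¹' S = (fun y => x + y) '' (ρ • S) := by
    ext z
    simp only [mem_preimage, mem_image, mem_smul_set]
    constructor
    · intro h
      exact ⟨ρ • blowUp x ρ z, ⟨_, h, rfl⟩, blowDown_blowUp x hρ z⟩
    · rintro ⟨_, ⟨y, hy, rfl⟩, rfl⟩
      have := blowUp_blowDown x hρ y
      rw [blowDown] at this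
      rwa [this]
  rw [h1, (isometry_add_left x).hausdorffMeasure_image (Or.inl zero_le_one),
    Measure.hausdorffMeasure_smul₀ zero_le_one hρ.ne', NNReal.rpow_one]
  simp only [smul_eq_mul, ENNReal.smul_def]
  congr 1
  rw [ENNReal.ofReal, Real.nnnorm_of_nonneg hρ.le, Real.toNNReal_of_nonneg hρ.le]

theorem integral_comp_blowUp {E : Type*} [NormedAddCommGroup E] [NormedSpace ℝ E]
    (x : Space n) {ρ : ℝ} (hρ : 0 < ρ) (F : Space n → E) :
    ∫ z, F (blowUp x ρ z) ∂μH[1] = ρ • ∫ y, F y ∂μH[1] := by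
  rw [← (measurableEmbedding_blowUp x hρ).integral_map, map_blowUp_hausdorff x hρ,
    integral_smul_measure, ENNReal.toReal_ofReal hρ.le]

theorem lintegral_comp_blowUp (x : Space n) {ρ : ℝ} (hρ : 0 < ρ) (F : Space n → ℝ≥0∞) :
    ∫⁻ z, F (blowUp x ρ z) ∂μH[1] = ENNReal.ofReal ρ * ∫⁻ y, F y ∂μH[1] := by
  rw [← (measurableEmbedding_blowUp x hρ).lintegral_map, map_blowUp_hausdorff x hρ,
    lintegral_smul_measure, smul_eq_mul]

theorem hausdorff_preimage_blowUp (x : Space n) {ρ : ℝ} (hρ : 0 < ρ) (S : Set (Space n)) :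
    (μH[1] : Measure (Space n)) (blowUp x ρ ⁻¹' S) = ENNReal.ofReal ρ * μH[1] S := by
  rw [← (measurableEmbedding_blowUp x hρ).map_apply, map_blowUp_hausdorff x hρ]; rfl

/-- The copy of a representation in `B_{1/2}`, scaled to `B(x, ρ/2)`. -/
noncomputable def RectRep.scale (T : RectRep m n (halfBall n)) (x : Space n) {ρ : ℝ} (hρ : 0 < ρ)
    {Ω : Set (Space n)} (hΩ : Metric.ball x (ρ / 2) ⊆ Ω) : RectRep m n Ω where
  carrier := blowUp x ρ ⁻¹' T.carrier
  mult := T.mult ∘ blowUp x ρ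
  tangent := T.tangent ∘ blowUp x ρ
  measurableSet_carrier := (continuous_blowUp x ρ).measurable T.measurableSet_carrier
  carrier_subset := fun z hz => hΩ ((blowUp_mem_halfBall x hρ z).1 (T.carrier_subset hz))
  rectifiable := by
    obtain ⟨c, hc, h0⟩ := T.rectifiable
    refine ⟨fun k s => blowDown x ρ (c k s), fun k => ?_, ?_⟩
    · obtain ⟨K, hK⟩ := hc k
      refine ⟨‖ρ‖₊ * K, LipschitzWith.of_dist_le_mul fun s s' => ?_⟩
      have := hK.dist_le_mul s s'
      simp only [blowDown, dist_add_left, dist_smul₀, NNReal.coe_mul, coe_nnnorm, mul_assoc]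
      gcongr
    · have : blowUp x ρ ⁻¹' T.carrier \ ⋃ k, range (fun s => blowDown x ρ (c k s)) ⊆
          blowUp x ρ ⁻¹' (T.carrier \ ⋃ k, range (c k)) := by
        rintro z ⟨hz, hzn⟩
        refine ⟨hz, fun hzu => hzn ?_⟩
        obtain ⟨k, s, hs⟩ := mem_iUnion.1 hzu
        refine mem_iUnion.2 ⟨k, s, ?_⟩
        simp only [hs, blowDown_blowUp x hρ]
      refine measure_mono_null this ?_
      rw [hausdorff_preimage_blowUp x hρ, h0, mul_zero]
  measurable_mult := T.measurable_mult.comp (continuous_blowUp x ρ).measurable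
  measurable_tangent := T.measurable_tangent.comp (continuous_blowUp x ρ).measurable
  isTangentTo := by
    rintro c ⟨K, hK⟩
    -- The curve is moved to the unscaled carrier; its velocity is only multiplied by `ρ⁻¹`, so it
    -- spans the same line.
    have hL : LipschitzWith (‖ρ⁻¹‖₊ * K) fun s => blowUp x ρ (c s) := by
      refine LipschitzWith.of_dist_le_mul fun s s' => ?_
      have := hK.dist_le_mul s s'
      simp only [blowUp, dist_smul₀, dist_sub_right, NNReal.coe_mul, coe_nnnorm, mul_assoc]
      gcongr
    filter_upwards [T.isTangentTo _ ⟨_, hL⟩] with s hs hsγ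
    have h := hs hsγ
    have hder : deriv (fun s => blowUp x ρ (c s)) s = ρ⁻¹ • deriv c s := by
      simp only [blowUp]
      rw [deriv_fun_const_smul_field, deriv_sub_const]
    rw [hder] at h
    simpa [smul_smul, hρ.ne'] using Submodule.smul_mem _ ρ h
  integrable := by
    rw [← integrable_indicator_iff ((continuous_blowUp x ρ).measurable T.measurableSet_carrier)]
    have h := (integrable_indicator_iff T.measurableSet_carrier).2 T.integrable
    have h2 : Integrable (T.carrier.indicator fun x => latticeNorm (T.mult x))
        ((μH[1] : Measure (Space n)).map (blowUp x ρ)) := by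
      rw [map_blowUp_hausdorff x hρ]
      exact h.smul_measure ENNReal.ofReal_ne_top
    exact (measurableEmbedding_blowUp x hρ).integrable_map_iff.1 h2

/-- No power of `ρ` appears: multiplicity and tangent are transported unchanged, and the scaling
factor enters only through `ℋ¹`. -/
theorem RectRep.dens_scale (T : RectRep m n (halfBall n)) (x : Space n) {ρ : ℝ} (hρ : 0 < ρ)
    {Ω : Set (Space n)} (hΩ : Metric.ball x (ρ / 2) ⊆ Ω) (z : Space n) :
    (T.scale x hρ hΩ).dens z = T.dens (blowUp x ρ z) := rfl

theorem RectRep.energyDens_scale (f : IntLattice m → UnitSphere n → ℝ≥0∞)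
    (T : RectRep m n (halfBall n)) (x : Space n) {ρ : ℝ} (hρ : 0 < ρ)
    {Ω : Set (Space n)} (hΩ : Metric.ball x (ρ / 2) ⊆ Ω) (z : Space n) :
    (T.scale x hρ hΩ).energyDens f z = T.energyDens f (blowUp x ρ z) := rfl

end Scaling

/-! ### Competitors of the cell problem: lower bound and surgery. -/

section CellProblem
variable {m n : ℕ}

/-- A divergence-free measure with boundary values `(b, t)` and the line `b ⊗ t ℋ¹ ⌞ ℝt` act in
the same way on the gradients of all smooth functions. -/
theorem integral_fderiv_dens_sub_lineDens {T : RectRep m n (halfBall n)} (hT : T.DivFree)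
    {b : IntLattice m} {t : UnitSphere n} (hb : HasLineBoundary T.toMeasure b t)
    {φ : Space n → ℝ} (hφ : ContDiff ℝ (⊤ : ℕ∞) φ) (i : Fin m) :
    ∫ x, fderiv ℝ φ x ((T.dens x - lineDens b t x) i) ∂μH[1] = 0 := by
  obtain ⟨r, hr, hae⟩ := (hasLineBoundary_toMeasure_iff T b t).1 hb
  -- `r` may be negative, whereas the cutoff needs positive radii. The two radii below trisect `[r₀,
  -- 1/2]`: the cutoff is `1` near every point where `T` and the line may differ, and its support
  -- stays inside `B_{1/2}`.
  set r₀ := max r 0 with hr₀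
  have h0 : 0 ≤ r₀ := le_max_right _ _
  have h1 : r₀ < 1 / 2 := max_lt hr (by norm_num)
  let η : ContDiffBump (0 : Space n) :=
    ⟨(2 * r₀ + 1 / 2) / 3, (r₀ + 1) / 3, by linarith, by linarith⟩
  set φ' : Space n → ℝ := fun x => η x * φ x with hφ'
  have hsm : ContDiff ℝ (⊤ : ℕ∞) φ' := η.contDiff.mul hφ
  have hcs : HasCompactSupport φ' := η.hasCompactSupport.mul_right
  have hts : tsupport φ' ⊆ halfBall n := by
    refine (closure_mono (Function.support_mul_subset_left _ _)).trans ?_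
    refine (η.tsupport_eq).subset.trans (Metric.closedBall_subset_ball ?_)
    change (r₀ + 1) / 3 < 1 / 2
    linarith
  have hη : ∀ s : ℝ, |s| = 1 / 2 → φ' (s • (t : Space n)) = 0 := fun s =>
    apply_smul_sphere_eq_zero hts t
  have e1 : ∫ x, fderiv ℝ φ' x (T.dens x i) ∂μH[1] = 0 := T.divFree_iff.1 hT φ' hsm hcs hts i
  have e2 : ∫ x, fderiv ℝ φ' x (lineDens b t x i) ∂μH[1] = 0 := by
    rw [integral_fderiv_lineDens b t hsm i, hη _ (by norm_num), hη _ (by norm_num)]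
    simp
  have e3 : ∫ x, fderiv ℝ φ x ((T.dens x - lineDens b t x) i) ∂μH[1] =
      ∫ x, (fderiv ℝ φ' x (T.dens x i) - fderiv ℝ φ' x (lineDens b t x i)) ∂μH[1] := by
    refine integral_congr_ae ?_
    filter_upwards [hae] with x hx
    rw [← map_sub]
    change _ = fderiv ℝ φ' x ((T.dens x - lineDens b t x) i)
    -- Inside the ball the cutoff is locally `1`; outside, the two densities agree and both sides
    -- vanish.
    by_cases hxr : x ∈ Metric.closedBall 0 r
    · have : φ' =ᶠ[nhds x] φ := by
        have hlt : ‖x‖ < (2 * r₀ + 1 / 2) / 3 := by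
          have := mem_closedBall_zero_iff.1 hxr
          have := le_max_left r 0
          linarith
        filter_upwards [Metric.isOpen_ball.mem_nhds (mem_ball_zero_iff.2 hlt)] with y hy
        rw [hφ']
        simp only
        rw [η.one_of_mem_closedBall (Metric.ball_subset_closedBall hy), one_mul]
      rw [this.fderiv_eq]
    · simp [hx hxr]
  rw [e3, integral_sub (integrable_fderiv_apply hsm hcs T.integrable_dens i)
    (integrable_fderiv_apply hsm hcs (integrable_lineDens b t) i), e1, e2, sub_zero]

/-- The linear function `⟨t, ·⟩` is a legitimate test function for `T` minus the line, and on the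
line, of length `1`, the integral is explicit. -/
theorem integral_inner_dens {T : RectRep m n (halfBall n)} (hT : T.DivFree)
    {b : IntLattice m} {t : UnitSphere n} (hb : HasLineBoundary T.toMeasure b t) (i : Fin m) :
    ∫ x, inner ℝ (t : Space n) (T.dens x i) ∂μH[1] = b i := by
  have hfd : ∀ x, fderiv ℝ (innerSL ℝ (t : Space n)) x = innerSL ℝ (t : Space n) := fun x =>
    (innerSL ℝ (t : Space n)).fderiv
  have hcd : ContDiff ℝ (⊤ : ℕ∞) (innerSL ℝ (t : Space n)) := (innerSL ℝ (t : Space n)).contDiff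
  have h1 := integral_fderiv_dens_sub_lineDens hT hb hcd i
  have h2 := integral_fderiv_lineDens b t hcd i
  simp only [hfd, Pi.sub_apply, map_sub] at h1 h2
  rw [integral_sub ((innerSL ℝ (t : Space n)).integrable_comp (T.integrable_dens.eval i))
    ((innerSL ℝ (t : Space n)).integrable_comp ((integrable_lineDens b t).eval i)), h2,
    sub_eq_zero] at h1
  simp only [innerSL_apply_apply, inner_smul_right, real_inner_self_eq_norm_sq,
    norm_coe_sphere] at h1
  rw [h1]; norm_num

/-- The mass of a divergence-free measure is at least that of the line with the same boundary
values. -/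
theorem latticeNorm_le_integral {T : RectRep m n (halfBall n)} (hT : T.DivFree)
    {b : IntLattice m} {t : UnitSphere n} (hb : HasLineBoundary T.toMeasure b t) :
    latticeNorm b ≤ ∫ x in T.carrier, latticeNorm (T.mult x) ∂μH[1] := by
  rcases (latticeNorm_nonneg b).eq_or_lt with h0 | h0
  · rw [← h0]
    exact integral_nonneg fun _ => latticeNorm_nonneg _
  have hint : ∀ i, Integrable (fun x => (b i : ℝ) * inner ℝ (t : Space n) (T.dens x i)) μH[1] :=
    fun i => ((innerSL ℝ (t : Space n)).integrable_comp (T.integrable_dens.eval i)).const_mul _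
  -- Calibration: the density is paired with the constant matrix `b ⊗ t`. The total is `|b|²`, while
  -- Cauchy–Schwarz bounds the integrand by `|b| |θ|`.
  have h1 : latticeNorm b ^ 2 =
      ∫ x, ∑ i, (b i : ℝ) * inner ℝ (t : Space n) (T.dens x i) ∂μH[1] := by
    rw [integral_finsetSum _ fun i _ => hint i, latticeNorm_sq]
    refine Finset.sum_congr rfl fun i _ => ?_
    rw [integral_const_mul, integral_inner_dens hT hb i, sq]
  have h2 : latticeNorm b ^ 2 ≤
      ∫ x, latticeNorm b * T.carrier.indicator (fun x => latticeNorm (T.mult x)) x ∂μH[1] := by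
    rw [h1]
    refine integral_mono (integrable_finsetSum _ fun i _ => hint i)
      (((integrable_indicator_iff T.measurableSet_carrier).2 T.integrable).const_mul _) fun x => ?_
    simp only
    by_cases hx : x ∈ T.carrier
    · simp only [T.dens_of_mem hx, tensor_apply, inner_smul_right, indicator_of_mem hx]
      have hin : |inner ℝ (t : Space n) (T.tangent x : Space n)| ≤ 1 := by
        simpa [norm_coe_sphere] using abs_real_inner_le_norm (t : Space n) (T.tangent x : Space n)
      have hcs := Real.sum_mul_le_sqrt_mul_sqrt Finset.univ (fun i => |(b i : ℝ)|)
        (fun i => |(T.mult x i : ℝ)|)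
      simp only [sq_abs] at hcs
      refine le_trans (Finset.sum_le_sum fun i _ => ?_) hcs
      calc (b i : ℝ) * ((T.mult x i : ℝ) * inner ℝ (t : Space n) (T.tangent x : Space n))
          ≤ |(b i : ℝ) * ((T.mult x i : ℝ) * inner ℝ (t : Space n) (T.tangent x : Space n))| :=
            le_abs_self _
        _ = |(b i : ℝ)| * |(T.mult x i : ℝ)| *
            |inner ℝ (t : Space n) (T.tangent x : Space n)| := by rw [abs_mul, abs_mul, mul_assoc]
        _ ≤ |(b i : ℝ)| * |(T.mult x i : ℝ)| := mul_le_of_le_one_right (by positivity) hin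
    · simp [T.dens_of_notMem hx, hx]
  rw [integral_const_mul, integral_indicator T.measurableSet_carrier, sq] at h2
  exact le_of_mul_le_mul_left h2 h0

theorem ofReal_le_ellipticEnvelope {ψ : IntLattice m → UnitSphere n → ℝ≥0} {c₀ : ℝ}
    (hc₀ : 0 < c₀) (hψ : ∀ b t, c₀ * latticeNorm b ≤ (ψ b t : ℝ)) (b : IntLattice m)
    (t : UnitSphere n) : ENNReal.ofReal (c₀ * latticeNorm b) ≤ ellipticEnvelope ψ b t := by
  refine le_iInf fun T => le_iInf fun hT => le_iInf fun hb => ?_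
  calc ENNReal.ofReal (c₀ * latticeNorm b)
      ≤ ENNReal.ofReal (∫ x in T.carrier, c₀ * latticeNorm (T.mult x) ∂μH[1]) := by
        rw [integral_const_mul]
        gcongr
        exact latticeNorm_le_integral hT hb
    _ = ∫⁻ x in T.carrier, ENNReal.ofReal (c₀ * latticeNorm (T.mult x)) ∂μH[1] :=
        ofReal_integral_eq_lintegral_ofReal (T.integrable.const_mul c₀)
          (ae_of_all _ fun x => mul_nonneg hc₀.le (latticeNorm_nonneg _))
    _ ≤ T.energy fun b' t' => (ψ b' t' : ℝ≥0∞) := by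
        refine lintegral_mono fun x => ?_
        exact ENNReal.ofReal_le_of_le_toReal (hψ _ _)

/-- The representation of `b ⊗ t ℋ¹ ⌞ S` for a subset `S` of a line of direction `t`. -/
def RectRep.const {Ω : Set (Space n)} (b : IntLattice m) (t : UnitSphere n) (p : Space n)
    {S : Set (Space n)} (hS : MeasurableSet S) (hΩ : S ⊆ Ω)
    (hl : S ⊆ range fun s : ℝ => p + s • (t : Space n)) (hfin : μH[1] S ≠ ∞) :
    RectRep m n Ω where
  carrier := S
  mult := fun _ => b
  tangent := fun _ => t
  measurableSet_carrier := hS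
  carrier_subset := hΩ
  rectifiable := isRectifiable_of_subset_line hl
  measurable_mult := measurable_const
  measurable_tangent := measurable_const
  isTangentTo := isTangentTo_of_subset_line hl fun _ _ => rfl
  integrable := integrableOn_const hfin

/-- Disjoint segments with constant multiplicities can be represented. -/
theorem exists_polyRep {Ω : Set (Space n)} {ι : Type*} {p q : ι → Space n}
    {bs : ι → IntLattice m} {ts : ι → UnitSphere n} (t₀ : UnitSphere n) (hne : ∀ i, p i ≠ q i)
    (hdir : ∀ i, q i - p i = ‖q i - p i‖ • (ts i : Space n))
    (hΩ : ∀ i, openSegment ℝ (p i) (q i) ⊆ Ω)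
    (hdisj : Pairwise fun i j => Disjoint (openSegment ℝ (p i) (q i)) (openSegment ℝ (p j) (q j)))
    (s : Finset ι) : ∃ P : RectRep m n Ω,
      P.carrier = ⋃ i ∈ s, openSegment ℝ (p i) (q i) ∧
      (∀ x, P.dens x = ∑ i ∈ s, (openSegment ℝ (p i) (q i)).indicator
        (fun _ => tensor (bs i) (ts i : Space n)) x) ∧
      ∀ f x, P.energyDens f x = ∑ i ∈ s, (openSegment ℝ (p i) (q i)).indicator
        (fun _ => f (bs i) (ts i)) x := by
  classical
  induction s using Finset.induction_on with
  | empty =>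
    -- `t₀` only supplies a value for the tangent field on the empty carrier, as the type of unit
    -- vectors may be empty.
    refine ⟨RectRep.const 0 t₀ 0 MeasurableSet.empty (empty_subset _) (empty_subset _) (by simp),
      by simp [RectRep.const], ?_, ?_⟩
    · intro x; simp [RectRep.dens, RectRep.const]
    · intro f x; simp [RectRep.energyDens, RectRep.const]
  | insert j s hj ih =>
    obtain ⟨P, hc, hd, he⟩ := ih
    have hl : openSegment ℝ (p j) (q j) ⊆ range fun u : ℝ => p j + u • (ts j : Space n) := by
      rw [openSegment_eq_image_line (hne j) (hdir j)]; exact image_subset_range _ _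
    let Q : RectRep m n Ω := RectRep.const (bs j) (ts j) (p j)
      (measurableSet_openSegment (hne j) (hdir j)) (hΩ j) hl
      (by rw [hausdorff_openSegment (hne j) (hdir j)]; exact ENNReal.ofReal_ne_top)
    have hQP : Disjoint Q.carrier P.carrier := by
      rw [hc, disjoint_iUnion₂_right]
      intro i hi
      exact hdisj fun h => hj (h ▸ hi)
    refine ⟨Q.union P hQP, ?_, ?_, ?_⟩
    · rw [Finset.set_biUnion_insert, ← hc]; rfl
    · intro x
      rw [RectRep.dens_union, Finset.sum_insert hj, ← hd]; rfl
    · intro f x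
      rw [RectRep.energyDens_union, Finset.sum_insert hj, ← he]; rfl

/-- Where a divergence-free measure is a straight line through the centre of a ball, it may be
replaced by a scaled competitor for the cell problem. -/
theorem exists_replace_ball {Ω : Set (Space n)} {R : RectRep m n Ω} (hR : R.DivFree)
    {T : RectRep m n (halfBall n)} (hT : T.DivFree) {b : IntLattice m} {t : UnitSphere n}
    (hb : HasLineBoundary T.toMeasure b t) {x : Space n} {ρ : ℝ} (hρ : 0 < ρ)
    (hΩ : Metric.ball x (ρ / 2) ⊆ Ω)
    (hline : ∀ z ∈ Metric.ball x (ρ / 2), R.dens z = lineDens b t (blowUp x ρ z))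
    (f : IntLattice m → UnitSphere n → ℝ≥0∞) : ∃ R' : RectRep m n Ω, R'.DivFree ∧
      (∀ z ∉ Metric.ball x (ρ / 2), R'.dens z = R.dens z ∧ R'.energyDens f z = R.energyDens f z) ∧
      ∫⁻ z in Metric.ball x (ρ / 2), R'.energyDens f z ∂μH[1] =
        ENNReal.ofReal ρ * T.energy f := by
  have hB : MeasurableSet (Metric.ball x (ρ / 2)) := measurableSet_ball
  have hd : Disjoint (R.restrict hB.compl).carrier (T.scale x hρ hΩ).carrier := by
    rw [disjoint_left]
    rintro z ⟨_, hz⟩ hz'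
    exact hz ((blowUp_mem_halfBall x hρ z).1 (T.carrier_subset hz'))
  have hout : ∀ z ∉ Metric.ball x (ρ / 2), blowUp x ρ z ∉ halfBall n := fun z hz h =>
    hz ((blowUp_mem_halfBall x hρ z).1 h)
  refine ⟨(R.restrict hB.compl).union (T.scale x hρ hΩ) hd, ?_, ?_, ?_⟩
  · rw [RectRep.divFree_iff]
    intro φ hφ hc hs i
    -- The new density is the old one plus the rescaled difference of competitor and line.
    have hdec : ∀ z, ((R.restrict hB.compl).union (T.scale x hρ hΩ) hd).dens z =
        R.dens z + (T.dens (blowUp x ρ z) - lineDens b t (blowUp x ρ z)) := by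
      intro z
      rw [RectRep.dens_union, Pi.add_apply, RectRep.dens_restrict, RectRep.dens_scale]
      by_cases hz : z ∈ Metric.ball x (ρ / 2)
      · rw [indicator_of_notMem (notMem_compl_iff.2 hz), hline z hz]; abel
      · rw [indicator_of_mem (show z ∈ (Metric.ball x (ρ / 2))ᶜ from hz), lineDens,
          indicator_of_notMem fun h => hout z hz (diameter_subset_halfBall t h), sub_zero]
    have hi1 : Integrable (fun z => fderiv ℝ φ z (R.dens z i)) μH[1] :=
      integrable_fderiv_apply hφ hc R.integrable_dens i
    have hD : Integrable (fun z => T.dens (blowUp x ρ z) - lineDens b t (blowUp x ρ z)) μH[1] := by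
      have := (T.integrable_dens.sub (integrable_lineDens b t)).smul_measure
        (ENNReal.ofReal_ne_top (r := ρ))
      rw [← map_blowUp_hausdorff x hρ] at this
      exact (measurableEmbedding_blowUp x hρ).integrable_map_iff.1 this
    have hi2 := integrable_fderiv_apply hφ hc hD i
    have hz2 : ∫ z, fderiv ℝ φ z ((T.dens (blowUp x ρ z) - lineDens b t (blowUp x ρ z)) i)
        ∂μH[1] = 0 := by
      have hcov := integral_comp_blowUp x hρ
        fun y => fderiv ℝ φ (blowDown x ρ y) ((T.dens y - lineDens b t y) i)
      simp only [blowDown_blowUp x hρ] at hcov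
      rw [hcov]
      -- The rescaled test function need not vanish near the sphere of `B_{1/2}`, so the identity
      -- for all smooth functions is indispensable. The chain rule produces the same factor `ρ` as
      -- the change of variables.
      have hφ2 : ContDiff ℝ (⊤ : ℕ∞) (φ ∘ blowDown x ρ) := by
        refine hφ.comp ?_
        unfold blowDown
        fun_prop
      have h0 := integral_fderiv_dens_sub_lineDens hT hb hφ2 i
      have hfd : ∀ y, fderiv ℝ (φ ∘ blowDown x ρ) y = ρ • fderiv ℝ φ (blowDown x ρ y) := by
        intro y
        have hb : HasFDerivAt (blowDown x ρ) (ρ • ContinuousLinearMap.id ℝ (Space n)) y :=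
          ((hasFDerivAt_id y).const_smul ρ).const_add x
        rw [((hφ.differentiable (by simp) _).hasFDerivAt.comp y hb).fderiv,
          ContinuousLinearMap.comp_smul, ContinuousLinearMap.comp_id]
      simp only [hfd, _root_.smul_apply] at h0
      rw [integral_smul] at h0
      exact h0
    simp only [hdec, Pi.add_apply, map_add]
    rw [integral_add hi1 hi2, R.divFree_iff.1 hR φ hφ hc hs i, hz2, add_zero]
  · intro z hz
    have hzc : z ∈ (Metric.ball x (ρ / 2))ᶜ := hz
    have hnm : z ∉ (T.scale x hρ hΩ).carrier := fun h => hout z hz (T.carrier_subset h)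
    constructor
    · rw [RectRep.dens_union, Pi.add_apply, RectRep.dens_restrict, indicator_of_mem hzc,
        RectRep.dens_of_notMem _ hnm, add_zero]
    · rw [RectRep.energyDens_union, Pi.add_apply, RectRep.energyDens_restrict,
        indicator_of_mem hzc]
      simp [RectRep.energyDens, hnm]
  · rw [RectRep.energy_eq_lintegral, ← lintegral_comp_blowUp x hρ, ← lintegral_indicator hB]
    congr 1
    ext1 z
    by_cases hz : z ∈ Metric.ball x (ρ / 2)
    · rw [indicator_of_mem hz, RectRep.energyDens_union, Pi.add_apply,
        RectRep.energyDens_restrict, indicator_of_notMem (notMem_compl_iff.2 hz), zero_add,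
        RectRep.energyDens_scale]
    · rw [indicator_of_notMem hz, RectRep.energyDens,
        indicator_of_notMem fun h => hout z hz (T.carrier_subset h)]

end CellProblem

/-! ### Covering segments by balls in which they are diameters. -/

section Covering
variable {m n : ℕ}

/-- A point that is not a vertex has positive distance from the other closed segments and from the
endpoints of its own, so every smaller radius works. The sphere then meets the network in at most
two points; this null set is what separates closed from open balls in the covering. -/
theorem exists_radius_of_mem_openSegment {ι : Type*} [Finite ι] {p q : ι → Space n}
    {ts : ι → UnitSphere n} (hne : ∀ i, p i ≠ q i)
    (hdir : ∀ i, q i - p i = ‖q i - p i‖ • (ts i : Space n))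
    (hdisj : Pairwise fun i j => Disjoint (openSegment ℝ (p i) (q i)) (openSegment ℝ (p j) (q j)))
    {x : Space n} {i : ι} (hx : x ∈ openSegment ℝ (p i) (q i)) (hp : ∀ j, x ≠ p j)
    (hq : ∀ j, x ≠ q j) :
    ∃ R > 0, ∀ r, 0 < r → r < R →
      (∀ z ∈ Metric.ball x r, z ∈ openSegment ℝ (p i) (q i) ↔
        blowUp x (2 * r) z ∈ diameter (ts i)) ∧
      (∀ z ∈ Metric.closedBall x r, ∀ j ≠ i, z ∉ openSegment ℝ (p j) (q j)) ∧
      μH[1] (Metric.sphere x r ∩ ⋃ j, openSegment ℝ (p j) (q j)) = 0 := by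
  have hopen : IsOpen (⋂ j : {j // j ≠ i}, (segment ℝ (p j) (q j))ᶜ) := by
    refine isOpen_iInter_of_finite fun j => ?_
    rw [isOpen_compl_iff, ← closure_openSegment]
    exact isClosed_closure
  have hxo : x ∈ ⋂ j : {j // j ≠ i}, (segment ℝ (p j) (q j))ᶜ := by
    refine mem_iInter.2 fun j hj => ?_
    rw [← insert_endpoints_openSegment] at hj
    rcases hj with h | h | h
    · exact hp _ h
    · exact hq _ h
    · exact (hdisj j.2).le_bot ⟨h, hx⟩
  obtain ⟨R₀, hR₀, hball⟩ := Metric.isOpen_iff.1 hopen x hxo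
  have hx' := hx
  rw [openSegment_eq_image_line (hne i) (hdir i)] at hx'
  obtain ⟨s, ⟨hs0, hs1⟩, hsx⟩ := hx'
  simp only at hsx
  refine ⟨min R₀ (min s (‖q i - p i‖ - s)), lt_min hR₀ (lt_min hs0 (by linarith)), ?_⟩
  intro r hr hrR
  have hr1 : r < R₀ := hrR.trans_le (min_le_left _ _)
  have hr2 : r < s := hrR.trans_le ((min_le_right _ _).trans (min_le_left _ _))
  have hr3 : r < ‖q i - p i‖ - s := hrR.trans_le ((min_le_right _ _).trans (min_le_right _ _))
  have hoff : ∀ z ∈ Metric.closedBall x r, ∀ j ≠ i, z ∉ openSegment ℝ (p j) (q j) := by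
    intro z hz j hj hzj
    exact mem_iInter.1 (hball (Metric.closedBall_subset_ball hr1 hz)) ⟨j, hj⟩
      (openSegment_subset_segment _ _ _ hzj)
  have hpar : ∀ z ∈ openSegment ℝ (p i) (q i), ∃ u : ℝ, z = x + u • (ts i : Space n) ∧
      dist z x = |u| := by
    intro z hz
    rw [openSegment_eq_image_line (hne i) (hdir i)] at hz
    obtain ⟨s', -, rfl⟩ := hz
    have : p i + s' • (ts i : Space n) = x + (s' - s) • (ts i : Space n) := by
      rw [← hsx, sub_smul]; abel
    refine ⟨s' - s, this, ?_⟩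
    simp only [this]
    rw [dist_eq_norm, add_sub_cancel_left, norm_smul, norm_coe_sphere, mul_one, Real.norm_eq_abs]
  refine ⟨?_, hoff, ?_⟩
  · intro z hz
    constructor
    · intro hzs
      obtain ⟨u, rfl, hu⟩ := hpar z hzs
      rw [Metric.mem_ball, hu] at hz
      refine mem_diameter.2 ⟨(2 * r)⁻¹ * u, ?_, ?_⟩
      · rw [abs_mul, abs_of_pos (by positivity), inv_mul_lt_iff₀ (by positivity)]
        linarith
      · rw [blowUp, add_sub_cancel_left, smul_smul]
    · intro hzd
      obtain ⟨u, hu, hzu⟩ := mem_diameter.1 hzd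
      have hz2 : z = p i + (s + 2 * r * u) • (ts i : Space n) := by
        rw [← blowDown_blowUp x (by positivity : 0 < 2 * r) z, hzu, blowDown, ← hsx, add_smul,
          smul_smul, add_assoc]
      rw [openSegment_eq_image_line (hne i) (hdir i)]
      rw [abs_lt] at hu
      exact ⟨_, ⟨by nlinarith, by nlinarith⟩, hz2.symm⟩
  · refine measure_mono_null (t := {x + r • (ts i : Space n), x + (-r) • (ts i : Space n)}) ?_ ?_
    · rintro z ⟨hz, hzU⟩
      obtain ⟨j, hj⟩ := mem_iUnion.1 hzU
      have hji : j = i := by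
        by_contra h
        exact hoff z (Metric.sphere_subset_closedBall hz) j h hj
      subst hji
      obtain ⟨u, rfl, hu⟩ := hpar z hj
      rw [Metric.mem_sphere.1 hz, eq_comm, abs_eq hr.le] at hu
      rcases hu with rfl | rfl
      · exact Or.inl rfl
      · exact Or.inr rfl
    · have := Measure.nullSingletonClass_hausdorff (Space n) (d := 1) one_pos
      exact (Set.toFinite _).measure_zero _

/-- Almost all of a finite union of disjoint segments is covered by finitely many disjoint balls,
in each of which the union is a diameter of the ball. -/
theorem exists_finset_balls {ι : Type*} [Finite ι] [Nonempty ι] {p q : ι → Space n}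
    {ts : ι → UnitSphere n} (hne : ∀ i, p i ≠ q i)
    (hdir : ∀ i, q i - p i = ‖q i - p i‖ • (ts i : Space n))
    (hΩ : ∀ i, openSegment ℝ (p i) (q i) ⊆ halfBall n)
    (hdisj : Pairwise fun i j => Disjoint (openSegment ℝ (p i) (q i)) (openSegment ℝ (p j) (q j)))
    {ε : ℝ≥0∞} (hε : 0 < ε) :
    ∃ (s : Finset (Space n)) (r : Space n → ℝ) (k : Space n → ι),
      (∀ x ∈ s, 0 < r x ∧ ‖x‖ + r x < 1 / 2 ∧
        (∀ z ∈ Metric.ball x (r x), z ∈ openSegment ℝ (p (k x)) (q (k x)) ↔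
          blowUp x (2 * r x) z ∈ diameter (ts (k x))) ∧
        (∀ z ∈ Metric.ball x (r x), ∀ j ≠ k x, z ∉ openSegment ℝ (p j) (q j))) ∧
      (s : Set (Space n)).PairwiseDisjoint (fun x => Metric.ball x (r x)) ∧
      μH[1] ((⋃ i, openSegment ℝ (p i) (q i)) \ ⋃ x ∈ s, Metric.ball x (r x)) < ε := by
  classical
  have := Measure.nullSingletonClass_hausdorff (Space n) (d := 1) one_pos
  have := Fintype.ofFinite ι
  set Γ : Set (Space n) := ⋃ i, openSegment ℝ (p i) (q i) with hΓ
  have hΓm : MeasurableSet Γ := MeasurableSet.iUnion fun i =>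
    measurableSet_openSegment (hne i) (hdir i)
  have hΓfin : (μH[1] : Measure (Space n)) Γ ≠ ∞ := by
    refine ((measure_iUnion_fintype_le _ _).trans_lt ?_).ne
    refine ENNReal.sum_lt_top.2 fun i _ => ?_
    rw [hausdorff_openSegment (hne i) (hdir i)]
    exact ENNReal.ofReal_lt_top
  set Z : Set (Space n) := range p ∪ range q with hZ
  have hZ0 : (μH[1] : Measure (Space n)) Z = 0 :=
    ((finite_range p).union (finite_range q)).measure_zero _
  -- Stated for every `x`, with dummy values off `Γ \ Z`, so that choice yields total functions.
  have hloc : ∀ x : Space n, ∃ (i : ι) (R : ℝ), x ∈ Γ \ Z → 0 < R ∧ ∀ r, 0 < r → r < R →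
      ‖x‖ + r < 1 / 2 ∧
      (∀ z ∈ Metric.ball x r, z ∈ openSegment ℝ (p i) (q i) ↔
        blowUp x (2 * r) z ∈ diameter (ts i)) ∧
      (∀ z ∈ Metric.closedBall x r, ∀ k ≠ i, z ∉ openSegment ℝ (p k) (q k)) ∧
      μH[1] (Metric.sphere x r ∩ Γ) = 0 := by
    intro x
    by_cases hx : x ∈ Γ \ Z
    · obtain ⟨i, hi⟩ := mem_iUnion.1 hx.1
      obtain ⟨R, hR, h⟩ := exists_radius_of_mem_openSegment hne hdir hdisj hi
        (fun j h => hx.2 (Or.inl ⟨j, h.symm⟩)) (fun j h => hx.2 (Or.inr ⟨j, h.symm⟩))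
      have hxb := mem_ball_zero_iff.1 (hΩ i hi)
      refine ⟨i, min R (1 / 2 - ‖x‖), fun _ => ⟨lt_min hR (by linarith), ?_⟩⟩
      intro r hr hrR
      have h1 := hrR.trans_le (min_le_left _ _)
      have h2 := hrR.trans_le (min_le_right _ _)
      exact ⟨by linarith, h r hr h1⟩
    · exact ⟨Classical.arbitrary ι, 0, fun h => (hx h).elim⟩
  choose k R hkR using hloc
  have : IsFiniteMeasure ((μH[1] : Measure (Space n)).restrict Γ) := ⟨by
    rw [Measure.restrict_apply_univ]; exact hΓfin.lt_top⟩
  obtain ⟨c, r, hc, hcs, hr, h0, hd⟩ := Besicovitch.exists_disjoint_closedBall_covering_ae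
    ((μH[1] : Measure (Space n)).restrict Γ) (fun _ => univ) (Γ \ Z)
    (fun x _ δ hδ => by simpa using hδ) R (fun x hx => (hkR x hx).1)
  have hprop : ∀ x ∈ c, _ := fun x hx =>
    (hkR x (hcs hx)).2 (r x) (hr x hx).2.1 (hr x hx).2.2
  -- The covering theorem provides closed balls; passing to open ones loses only sphere points and
  -- vertices, a null set.
  have hnull : (μH[1] : Measure (Space n)) (Γ \ ⋃ x ∈ c, Metric.ball x (r x)) = 0 := by
    have hsub : Γ \ ⋃ x ∈ c, Metric.ball x (r x) ⊆
        (((Γ \ Z) \ ⋃ x ∈ c, Metric.closedBall x (r x)) ∩ Γ) ∪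
          (Z ∪ ⋃ x ∈ c, Metric.sphere x (r x) ∩ Γ) := by
      rintro z ⟨hz, hzn⟩
      by_cases hzZ : z ∈ Z
      · exact Or.inr (Or.inl hzZ)
      by_cases hzc : z ∈ ⋃ x ∈ c, Metric.closedBall x (r x)
      · right; right
        simp only [mem_iUnion, not_exists] at hzc hzn ⊢
        obtain ⟨x, hx, hzx⟩ := hzc
        have h1 := hzn x hx
        rw [Metric.mem_ball, not_lt] at h1
        exact ⟨x, hx, le_antisymm (Metric.mem_closedBall.1 hzx) h1, hz⟩
      · exact Or.inl ⟨⟨⟨hz, hzZ⟩, hzc⟩, hz⟩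
    refine measure_mono_null hsub (measure_union_null ?_ (measure_union_null hZ0 ?_))
    · rwa [Measure.restrict_apply' hΓm] at h0
    · exact (measure_biUnion_null_iff hc).2 fun x hx => (hprop x hx).2.2.2
  have := hc.to_subtype
  -- From countably to finitely many balls: the uncovered length decreases to zero by continuity
  -- from above, as `Γ` has finite length.
  have htend := tendsto_measure_iInter_atTop (μ := (μH[1] : Measure (Space n)))
    (s := fun s : Finset c => Γ \ ⋃ x ∈ s, Metric.ball (x : Space n) (r x))
    (fun s => (hΓm.diff (s.measurableSet_biUnion fun x _ => measurableSet_ball)).nullMeasurableSet)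
    (fun s s' hss => sdiff_subset_sdiff_right (biUnion_subset_biUnion_left hss))
    ⟨∅, by simpa using hΓfin⟩
  have hInt : (⋂ s : Finset c, Γ \ ⋃ x ∈ s, Metric.ball (x : Space n) (r x)) ⊆
      Γ \ ⋃ x ∈ c, Metric.ball x (r x) := by
    intro z hz
    rw [mem_iInter] at hz
    refine ⟨(hz ∅).1, fun hzu => ?_⟩
    simp only [mem_iUnion] at hzu
    obtain ⟨x, hx, hzx⟩ := hzu
    exact (hz {⟨x, hx⟩}).2 (by simpa using hzx)
  rw [measure_mono_null hInt hnull] at htend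
  obtain ⟨s, hs⟩ := (htend.eventually_lt_const hε).exists
  refine ⟨s.map ⟨Subtype.val, Subtype.val_injective⟩, r, k, ?_, ?_, ?_⟩
  · intro x hx
    obtain ⟨y, -, rfl⟩ := Finset.mem_map.1 hx
    obtain ⟨h1, h2, h3, -⟩ := hprop y y.2
    exact ⟨(hr y y.2).2.1, h1, h2, fun z hz => h3 z (Metric.ball_subset_closedBall hz)⟩
  · refine (hd.subset ?_).mono_on fun x _ => Metric.ball_subset_closedBall
    intro x hx
    obtain ⟨y, -, rfl⟩ := Finset.mem_map.1 hx
    exact y.2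
  · simpa using hs

end Covering

/-! ### The envelope and its comparison with polyhedral measures. -/

section Envelope
variable {m n : ℕ} {ψ : IntLattice m → UnitSphere n → ℝ≥0}

theorem ellipticEnvelope_le_energy {T : RectRep m n (halfBall n)} (hT : T.DivFree)
    {b : IntLattice m} {t : UnitSphere n} (hb : HasLineBoundary T.toMeasure b t) :
    ellipticEnvelope ψ b t ≤ T.energy fun b' t' => (ψ b' t' : ℝ≥0∞) :=
  iInf_le_of_le T (iInf_le_of_le hT (iInf_le _ hb))

theorem exists_energy_lt {b : IntLattice m} {t : UnitSphere n} {e : ℝ≥0∞}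
    (he : ellipticEnvelope ψ b t < e) : ∃ T : RectRep m n (halfBall n), T.DivFree ∧
      HasLineBoundary T.toMeasure b t ∧ (T.energy fun b' t' => (ψ b' t' : ℝ≥0∞)) < e := by
  simp only [ellipticEnvelope, iInf_lt_iff] at he
  obtain ⟨T, hT, hb, h⟩ := he
  exact ⟨T, hT, hb, h⟩

/-- The straight line is a competitor. -/
theorem ellipticEnvelope_le (b : IntLattice m) (t : UnitSphere n) :
    ellipticEnvelope ψ b t ≤ ψ b t := by
  have hl : diameter t ⊆ range fun u : ℝ => (0 : Space n) + u • (t : Space n) := by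
    intro x hx
    obtain ⟨s, -, rfl⟩ := mem_diameter.1 hx
    exact ⟨s, zero_add _⟩
  let T : RectRep m n (halfBall n) := RectRep.const b t 0 (measurableSet_diameter t)
    (diameter_subset_halfBall t) hl (by simp [hausdorff_diameter])
  have hd : T.dens = lineDens b t := rfl
  have hT : T.DivFree := by
    rw [RectRep.divFree_iff]
    intro φ hφ _ hs i
    have h0 : ∀ s : ℝ, |s| = 1 / 2 → φ (s • (t : Space n)) = 0 := fun s =>
      apply_smul_sphere_eq_zero hs t
    rw [hd, integral_fderiv_lineDens b t hφ i, h0 _ (by norm_num), h0 _ (by norm_num)]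
    simp
  have hb : HasLineBoundary T.toMeasure b t :=
    (hasLineBoundary_toMeasure_iff T b t).2 ⟨0, by norm_num, ae_of_all _ fun x _ => by rw [hd]⟩
  refine (ellipticEnvelope_le_energy hT hb).trans_eq ?_
  change ∫⁻ _ in diameter t, (ψ b t : ℝ≥0∞) ∂μH[1] = _
  rw [setLIntegral_const, hausdorff_diameter, mul_one]

theorem ellipticEnvelope_ne_top (b : IntLattice m) (t : UnitSphere n) :
    ellipticEnvelope ψ b t ≠ ∞ := ((ellipticEnvelope_le b t).trans_lt ENNReal.coe_lt_top).ne

theorem ellipticEnvelope_zero (h0 : ∀ t, ψ 0 t = 0) (t : UnitSphere n) :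
    ellipticEnvelope ψ (0 : IntLattice m) t = 0 := by
  have := ellipticEnvelope_le (ψ := ψ) 0 t
  rw [h0] at this
  exact le_antisymm this zero_le

/-- Both pairs prescribe the same boundary condition, so the infima run over the same competitors;
`ψ` itself need not be even. -/
theorem ellipticEnvelope_neg_neg (b : IntLattice m) (t : UnitSphere n) :
    ellipticEnvelope ψ (-b) (-t) = ellipticEnvelope ψ b t := by
  have : ∀ T : RectRep m n (halfBall n),
      HasLineBoundary T.toMeasure (-b) (-t) = HasLineBoundary T.toMeasure b t := fun T => by
    rw [hasLineBoundary_toMeasure_iff, hasLineBoundary_toMeasure_iff, lineDens_neg_neg]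
  simp only [ellipticEnvelope, this]

/-- The balls are treated one at a time; disjointness ensures that earlier replacements leave the
next ball untouched. -/
theorem exists_replace_finset {Ω : Set (Space n)} {P : RectRep m n Ω} (hP : P.DivFree)
    {b : Space n → IntLattice m} {t : Space n → UnitSphere n} {r : Space n → ℝ}
    {e : Space n → ℝ≥0∞} (s : Finset (Space n)) (hr : ∀ x ∈ s, 0 < r x)
    (hΩ : ∀ x ∈ s, Metric.ball x (r x) ⊆ Ω)
    (hd : (s : Set (Space n)).PairwiseDisjoint fun x => Metric.ball x (r x))
    (hline : ∀ x ∈ s, ∀ z ∈ Metric.ball x (r x),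
      P.dens z = lineDens (b x) (t x) (blowUp x (2 * r x) z))
    (he : ∀ x ∈ s, ellipticEnvelope ψ (b x) (t x) < e x) :
    ∃ R : RectRep m n Ω, R.DivFree ∧
      (∀ z ∉ ⋃ x ∈ s, Metric.ball x (r x), R.dens z = P.dens z ∧
        R.energyDens (fun b' t' => (ψ b' t' : ℝ≥0∞)) z =
          P.energyDens (fun b' t' => (ψ b' t' : ℝ≥0∞)) z) ∧
      ∫⁻ z in ⋃ x ∈ s, Metric.ball x (r x), R.energyDens (fun b' t' => (ψ b' t' : ℝ≥0∞)) z
        ∂μH[1] ≤ ∑ x ∈ s, ENNReal.ofReal (2 * r x) * e x := by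
  classical
  induction s using Finset.induction_on with
  | empty => exact ⟨P, hP, fun z _ => ⟨rfl, rfl⟩, by simp⟩
  | insert y s hy ih =>
    obtain ⟨R, hR, hRP, hRe⟩ := ih (fun x hx => hr x (Finset.mem_insert_of_mem hx))
      (fun x hx => hΩ x (Finset.mem_insert_of_mem hx))
      (hd.subset (by simp)) (fun x hx => hline x (Finset.mem_insert_of_mem hx))
      (fun x hx => he x (Finset.mem_insert_of_mem hx))
    have hys := Finset.mem_insert_self y s
    obtain ⟨T, hT, hb, hTe⟩ := exists_energy_lt (he y hys)
    have hρ : 0 < 2 * r y := by have := hr y hys; positivity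
    have h2 : 2 * r y / 2 = r y := by ring
    have hdis : Disjoint (Metric.ball y (r y)) (⋃ x ∈ s, Metric.ball x (r x)) := by
      rw [disjoint_iUnion₂_right]
      intro x hx
      exact hd (by simp) (by simp [hx]) fun h => hy (h ▸ hx)
    obtain ⟨R', hR', hout, hen⟩ := exists_replace_ball hR hT hb (x := y) hρ
      (by rw [h2]; exact hΩ y hys)
      (by
        rw [h2]
        intro z hz
        rw [(hRP z (hdis.notMem_of_mem_left hz)).1, hline y hys z hz])
      (fun b' t' => (ψ b' t' : ℝ≥0∞))
    rw [h2] at hout hen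
    refine ⟨R', hR', ?_, ?_⟩
    · intro z hz
      rw [Finset.set_biUnion_insert, mem_union, not_or] at hz
      rw [(hout z hz.1).1, (hout z hz.1).2]
      exact hRP z hz.2
    · rw [Finset.set_biUnion_insert, lintegral_union
        (s.measurableSet_biUnion fun x _ => measurableSet_ball) hdis, hen,
        Finset.sum_insert hy]
      refine add_le_add (by gcongr) (le_trans (le_of_eq ?_) hRe)
      refine setLIntegral_congr_fun (s.measurableSet_biUnion fun x _ => measurableSet_ball) ?_
      intro z hz
      exact (hout z (hdis.notMem_of_mem_right hz)).2

/-- Comparison of the cell problem with a divergence-free polyhedral measure. -/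
theorem ellipticEnvelope_le_sum {ι : Type*} [Fintype ι] {p q : ι → Space n}
    {bs : ι → IntLattice m} {ts : ι → UnitSphere n} (hne : ∀ i, p i ≠ q i)
    (hdir : ∀ i, q i - p i = ‖q i - p i‖ • (ts i : Space n))
    (hΩ : ∀ i, openSegment ℝ (p i) (q i) ⊆ halfBall n)
    (hdisj : Pairwise fun i j => Disjoint (openSegment ℝ (p i) (q i)) (openSegment ℝ (p j) (q j)))
    {P : RectRep m n (halfBall n)} (hP : P.DivFree)
    (hdens : ∀ x, P.dens x = ∑ i, (openSegment ℝ (p i) (q i)).indicator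
        (fun _ => tensor (bs i) (ts i : Space n)) x)
    (hen : ∀ f x, P.energyDens f x = ∑ i, (openSegment ℝ (p i) (q i)).indicator
        (fun _ => f (bs i) (ts i)) x)
    {b : IntLattice m} {t : UnitSphere n} (hb : HasLineBoundary P.toMeasure b t) :
    ellipticEnvelope ψ b t ≤
      ∑ i, μH[1] (openSegment ℝ (p i) (q i)) * ellipticEnvelope ψ (bs i) (ts i) := by
  classical
  have hSm : ∀ i, MeasurableSet (openSegment ℝ (p i) (q i)) := fun i =>
    measurableSet_openSegment (hne i) (hdir i)
  rcases isEmpty_or_nonempty ι with hι | hι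
  · refine (ellipticEnvelope_le_energy hP hb).trans ?_
    rw [RectRep.energy_eq_lintegral]
    simp [hen]
  -- The error per unit `ε`: `ψ` acts on the uncovered length, and the excess of the near-minimisers
  -- is paid along the total length.
  set K : ℝ≥0∞ := ∑ i, (ψ (bs i) (ts i) : ℝ≥0∞) + ∑ i, μH[1] (openSegment ℝ (p i) (q i)) with hK
  have hKtop : K ≠ ∞ := by
    refine ENNReal.add_ne_top.2 ⟨ENNReal.sum_ne_top.2 fun i _ => ENNReal.coe_ne_top,
      ENNReal.sum_ne_top.2 fun i _ => ?_⟩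
    rw [hausdorff_openSegment (hne i) (hdir i)]
    exact ENNReal.ofReal_ne_top
  have key : ∀ ε : ℝ≥0∞, 0 < ε → ellipticEnvelope ψ b t ≤
      ∑ i, μH[1] (openSegment ℝ (p i) (q i)) * ellipticEnvelope ψ (bs i) (ts i) + K * ε := by
    intro ε hε
    obtain ⟨s, r, k, hs, hd, hleft⟩ := exists_finset_balls hne hdir hΩ hdisj hε
    set U := ⋃ x ∈ s, Metric.ball x (r x) with hU
    have hUm : MeasurableSet U := s.measurableSet_biUnion fun x _ => measurableSet_ball
    have hout : ∀ x ∈ s, ∀ z ∈ Metric.ball x (r x), P.dens z =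
        lineDens (bs (k x)) (ts (k x)) (blowUp x (2 * r x) z) := by
      intro x hx z hz
      obtain ⟨-, -, h1, h2⟩ := hs x hx
      rw [hdens, Finset.sum_eq_single (k x)
        (fun j _ hj => indicator_of_notMem (h2 z hz j hj) _) (by simp), lineDens]
      by_cases hzs : z ∈ openSegment ℝ (p (k x)) (q (k x))
      · rw [indicator_of_mem hzs, indicator_of_mem ((h1 z hz).1 hzs)]
      · rw [indicator_of_notMem hzs, indicator_of_notMem fun h => hzs ((h1 z hz).2 h)]
    -- The scaling factor `2 r` of a competitor is exactly the length that it replaces.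
    have hlen : ∀ x ∈ s, ENNReal.ofReal (2 * r x) =
        μH[1] (openSegment ℝ (p (k x)) (q (k x)) ∩ Metric.ball x (r x)) := by
      intro x hx
      obtain ⟨hr, -, h1, -⟩ := hs x hx
      have hρ : 0 < 2 * r x := by positivity
      have h := hausdorff_preimage_blowUp x hρ (diameter (ts (k x)))
      rw [hausdorff_diameter, mul_one] at h
      rw [← h]
      congr 1
      ext z
      have hzb := blowUp_mem_halfBall x hρ z
      rw [show 2 * r x / 2 = r x by ring] at hzb
      constructor
      · intro hz
        have := hzb.1 (diameter_subset_halfBall _ hz)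
        exact ⟨(h1 z this).2 hz, this⟩
      · rintro ⟨hz, hzB⟩
        exact (h1 z hzB).1 hz
    obtain ⟨R, hR, hRP, hRe⟩ := exists_replace_finset (ψ := ψ) hP
      (b := fun x => bs (k x)) (t := fun x => ts (k x))
      (e := fun x => ellipticEnvelope ψ (bs (k x)) (ts (k x)) + ε) s (fun x hx => (hs x hx).1)
      (fun x hx z hz => by
        have h1 := (hs x hx).2.1
        rw [mem_ball_iff_norm] at hz
        rw [mem_ball_zero_iff]
        calc ‖z‖ = ‖x + (z - x)‖ := by rw [add_sub_cancel]
          _ ≤ ‖x‖ + ‖z - x‖ := norm_add_le _ _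
          _ < 1 / 2 := by linarith)
      hd hout (fun x hx => ENNReal.lt_add_right (ellipticEnvelope_ne_top _ _) hε.ne')
    have hRb : HasLineBoundary R.toMeasure b t := by
      rw [hasLineBoundary_toMeasure_iff] at hb ⊢
      obtain ⟨r₀, hr₀, hae⟩ := hb
      -- Finitely many balls, each compactly inside `B_{1/2}`, lie in a common smaller ball, so the
      -- surgery preserves the boundary values.
      obtain ⟨r₁, hr₁, hr₁s⟩ : ∃ r₁ < (1 / 2 : ℝ), ∀ x ∈ s, ‖x‖ + r x ≤ r₁ := by
        rcases s.eq_empty_or_nonempty with rfl | hne'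
        · exact ⟨0, by norm_num, by simp⟩
        · obtain ⟨y, hy, hmax⟩ := s.exists_max_image (fun x => ‖x‖ + r x) hne'
          exact ⟨_, (hs y hy).2.1, hmax⟩
      refine ⟨max r₀ r₁, max_lt hr₀ hr₁, ?_⟩
      filter_upwards [hae] with z hz hzr
      rw [mem_closedBall_zero_iff, not_le, max_lt_iff] at hzr
      rw [(hRP z ?_).1, hz]
      · rw [mem_closedBall_zero_iff, not_le]; exact hzr.1
      · simp only [mem_iUnion, not_exists]
        intro x hx hzx
        rw [mem_ball_iff_norm] at hzx
        have h1 : ‖z‖ ≤ ‖x‖ + ‖z - x‖ := by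
          simpa using norm_add_le x (z - x)
        linarith [hr₁s x hx, hzr.2]
    set f : IntLattice m → UnitSphere n → ℝ≥0∞ := fun b' t' => (ψ b' t' : ℝ≥0∞) with hf
    have hcover : ∑ x ∈ s, ENNReal.ofReal (2 * r x) *
        (ellipticEnvelope ψ (bs (k x)) (ts (k x)) + ε) ≤
        ∑ i, μH[1] (openSegment ℝ (p i) (q i)) * (ellipticEnvelope ψ (bs i) (ts i) + ε) := by
      set G : Space n → ℝ≥0∞ := fun z => ∑ i, (openSegment ℝ (p i) (q i)).indicator
        (fun _ => ellipticEnvelope ψ (bs i) (ts i) + ε) z with hG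
      calc _ ≤ ∑ x ∈ s, ∫⁻ z in Metric.ball x (r x), G z ∂μH[1] := by
            refine Finset.sum_le_sum fun x hx => ?_
            calc _ = ∫⁻ z in Metric.ball x (r x), (openSegment ℝ (p (k x)) (q (k x))).indicator
                  (fun _ => ellipticEnvelope ψ (bs (k x)) (ts (k x)) + ε) z ∂μH[1] := by
                  rw [lintegral_indicator (hSm _), setLIntegral_const,
                    Measure.restrict_apply (hSm _), hlen x hx, mul_comm]
              _ ≤ _ := lintegral_mono fun z => Finset.single_le_sum
                  (f := fun i => (openSegment ℝ (p i) (q i)).indicator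
                    (fun _ => ellipticEnvelope ψ (bs i) (ts i) + ε) z)
                  (fun _ _ => zero_le) (Finset.mem_univ (k x))
        _ = ∫⁻ z in U, G z ∂μH[1] :=
            (lintegral_biUnion_finset hd (fun x _ => measurableSet_ball) _).symm
        _ ≤ ∫⁻ z, G z ∂μH[1] := setLIntegral_le_lintegral _ _
        _ = _ := by
            rw [hG, lintegral_finsetSum _ fun i _ => measurable_const.indicator (hSm i)]
            refine Finset.sum_congr rfl fun i _ => ?_
            rw [lintegral_indicator (hSm i), setLIntegral_const, mul_comm]
    have hrest : ∫⁻ z in Uᶜ, R.energyDens f z ∂μH[1] ≤ ∑ i, (ψ (bs i) (ts i) : ℝ≥0∞) * ε := by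
      rw [setLIntegral_congr_fun hUm.compl fun z hz => (hRP z hz).2]
      simp only [hen]
      rw [lintegral_finsetSum _ fun i _ => measurable_const.indicator (hSm i)]
      refine Finset.sum_le_sum fun i _ => ?_
      rw [lintegral_indicator (hSm i), setLIntegral_const, Measure.restrict_apply (hSm i)]
      gcongr
      refine (measure_mono ?_).trans hleft.le
      exact inter_subset_inter_left _ (subset_iUnion (fun i => openSegment ℝ (p i) (q i)) i)
    calc ellipticEnvelope ψ b t ≤ R.energy f := ellipticEnvelope_le_energy hR hRb
      _ = ∫⁻ z in U, R.energyDens f z ∂μH[1] + ∫⁻ z in Uᶜ, R.energyDens f z ∂μH[1] := by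
          rw [RectRep.energy_eq_lintegral, lintegral_add_compl _ hUm]
      _ ≤ ∑ i, μH[1] (openSegment ℝ (p i) (q i)) * (ellipticEnvelope ψ (bs i) (ts i) + ε) +
          ∑ i, (ψ (bs i) (ts i) : ℝ≥0∞) * ε := add_le_add (hRe.trans hcover) hrest
      _ = _ := by
          simp only [hK, mul_add, add_mul, Finset.sum_add_distrib, Finset.sum_mul]
          ring
  refine ENNReal.le_of_forall_pos_le_add fun δ hδ _ => ?_
  have hδ' : (0 : ℝ≥0∞) < δ / (K + 1) :=
    ENNReal.div_pos (by exact_mod_cast hδ.ne') (ENNReal.add_ne_top.2 ⟨hKtop, ENNReal.one_ne_top⟩)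
  refine (key _ hδ').trans ?_
  gcongr
  calc K * (δ / (K + 1)) ≤ (K + 1) * (δ / (K + 1)) := by gcongr; exact le_self_add
    _ ≤ δ := ENNReal.mul_div_le

end Envelope

/-! ### Independence of the representation, and polygonal networks. -/

section Polyhedral
variable {m n : ℕ} {ψ : IntLattice m → UnitSphere n → ℝ≥0}

/-- For unit vectors a nonzero rank-one matrix fixes its factors up to a common sign; a nonzero
entry of `b` decides which sign occurs. -/
theorem tensor_eq_tensor {b b' : IntLattice m} {t t' : UnitSphere n}
    (h : tensor b (t : Space n) = tensor b' (t' : Space n)) :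
    (b = 0 ∧ b' = 0) ∨ (b' = b ∧ t' = t) ∨ (b' = -b ∧ t' = -t) := by
  have hi : ∀ i, (b i : ℝ) • (t : Space n) = (b' i : ℝ) • (t' : Space n) := fun i => congrFun h i
  have habs : ∀ i, |(b i : ℝ)| = |(b' i : ℝ)| := fun i => by
    simpa [norm_smul, norm_coe_sphere] using congrArg norm (hi i)
  have ht0 : (t : Space n) ≠ 0 := norm_ne_zero_iff.1 (by rw [norm_coe_sphere]; exact one_ne_zero)
  by_cases hb : b = 0
  · refine Or.inl ⟨hb, funext fun i => ?_⟩
    have := habs i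
    simpa [hb, eq_comm] using this
  · right
    obtain ⟨i, hbi⟩ := Function.ne_iff.1 hb
    have hbi' : (b i : ℝ) ≠ 0 := by exact_mod_cast hbi
    rcases abs_eq_abs.1 (habs i) with h1 | h1
    · left
      have htt : (t' : Space n) = t := by
        have := hi i
        rw [h1] at this hbi'
        exact (smul_right_injective _ hbi' this).symm
      refine ⟨funext fun j => ?_, Subtype.ext htt⟩
      have := hi j
      rw [htt] at this
      exact_mod_cast (smul_left_injective ℝ ht0 this).symm
    · right
      have htt : (t' : Space n) = -t := by
        have := hi i
        have hne : (b' i : ℝ) ≠ 0 := fun h => hbi' (by rw [h1, h, neg_zero])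
        rw [h1, neg_smul, ← smul_neg] at this
        exact (smul_right_injective _ hne this).symm
      refine ⟨funext fun j => ?_, Subtype.ext htt⟩
      have := hi j
      rw [htt, smul_neg, ← neg_smul] at this
      have h2 : (b j : ℝ) = -(b' j : ℝ) := smul_left_injective ℝ ht0 this
      have h3 : b j = -b' j := by exact_mod_cast h2
      rw [Pi.neg_apply, h3, neg_neg]

/-- The line energy of an even integrand depends only on the measure. -/
theorem RectRep.energyDens_eq_of_dens_eq {Ω : Set (Space n)}
    {f : IntLattice m → UnitSphere n → ℝ≥0∞} (h0 : ∀ t, f 0 t = 0)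
    (heven : ∀ b t, f (-b) (-t) = f b t) {T P : RectRep m n Ω} {x : Space n}
    (h : T.dens x = P.dens x) : T.energyDens f x = P.energyDens f x := by
  have hz : ∀ (b : IntLattice m) (t : UnitSphere n), tensor b (t : Space n) = 0 → f b t = 0 := by
    intro b t hbt
    rw [← tensor_zero_left (m := m) (t : Space n)] at hbt
    rcases tensor_eq_tensor hbt with h | h | h
    · rw [h.1, h0]
    · rw [← h.1, h0]
    · rw [← neg_neg b, ← h.1, neg_zero, h0]
  by_cases hT : x ∈ T.carrier <;> by_cases hP : x ∈ P.carrier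
  · rw [T.dens_of_mem hT, P.dens_of_mem hP] at h
    rw [energyDens, energyDens, indicator_of_mem hT, indicator_of_mem hP]
    rcases tensor_eq_tensor h with h | h | h
    · rw [h.1, h.2, h0, h0]
    · rw [h.1, h.2]
    · rw [h.1, h.2, heven]
  · rw [T.dens_of_mem hT, P.dens_of_notMem hP] at h
    rw [energyDens, energyDens, indicator_of_mem hT, indicator_of_notMem hP, hz _ _ h]
  · rw [T.dens_of_notMem hT, P.dens_of_mem hP] at h
    rw [energyDens, energyDens, indicator_of_notMem hT, indicator_of_mem hP, hz _ _ h.symm]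
  · rw [energyDens, energyDens, indicator_of_notMem hT, indicator_of_notMem hP]

theorem polyMeasure_apply {N : ℕ} {p q : Fin N → Space n} {bs : Fin N → IntLattice m}
    {ts : Fin N → UnitSphere n} (hne : ∀ i, p i ≠ q i)
    (hdir : ∀ i, q i - p i = ‖q i - p i‖ • (ts i : Space n)) {A : Set (Space n)}
    (hA : MeasurableSet A) : polyMeasure p q bs ts A = ∫ x in A, ∑ i,
      (openSegment ℝ (p i) (q i)).indicator (fun _ => tensor (bs i) (ts i : Space n)) x ∂μH[1] := by
  have hSm : ∀ i, MeasurableSet (openSegment ℝ (p i) (q i)) := fun i =>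
    measurableSet_openSegment (hne i) (hdir i)
  have hint : ∀ i, IntegrableOn (fun _ : Space n => tensor (bs i) (ts i : Space n))
      (openSegment ℝ (p i) (q i)) μH[1] := fun i => by
    refine integrableOn_const ?_
    rw [hausdorff_openSegment (hne i) (hdir i)]
    exact ENNReal.ofReal_ne_top
  have hsum : ∀ s : Finset (Fin N),
      (∑ i ∈ s, ((μH[1] : Measure (Space n)).restrict (openSegment ℝ (p i) (q i))).withDensityᵥ
        fun _ => tensor (bs i) (ts i : Space n)) A =
      ∑ i ∈ s, (((μH[1] : Measure (Space n)).restrict (openSegment ℝ (p i) (q i))).withDensityᵥ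
        fun _ => tensor (bs i) (ts i : Space n)) A := by
    intro s
    classical
    induction s using Finset.induction_on with
    | empty => simp
    | insert j s hj ih => rw [Finset.sum_insert hj, Finset.sum_insert hj,
        _root_.add_apply, ih]
  rw [polyMeasure, hsum, integral_finsetSum _ fun i _ =>
    ((integrable_indicator_iff (hSm i)).2 (hint i)).restrict]
  refine Finset.sum_congr rfl fun i _ => ?_
  rw [withDensityᵥ_apply (hint i) hA, setIntegral_indicator (hSm i), Measure.restrict_restrict hA]

/-- The canonical representation `P` of the segments has the same density as `T` almost everywhere.
It therefore inherits divergence freeness and, `ψ̄` being even and zero at multiplicity zero, has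
the same relaxed energy. -/
theorem ellipticEnvelope_le_sum_and_sum_eq_energy {N : ℕ} (hψ0 : ∀ t, ψ 0 t = 0)
    {p q : Fin N → Space n} {bs : Fin N → IntLattice m} {ts : Fin N → UnitSphere n}
    (hne : ∀ i, p i ≠ q i) (hdir : ∀ i, q i - p i = ‖q i - p i‖ • (ts i : Space n))
    (hΩ : ∀ i, openSegment ℝ (p i) (q i) ⊆ halfBall n)
    (hdisj : Pairwise fun i j => Disjoint (openSegment ℝ (p i) (q i)) (openSegment ℝ (p j) (q j)))
    {b : IntLattice m} {t : UnitSphere n} (hb : HasLineBoundary (polyMeasure p q bs ts) b t)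
    {T : RectRep m n (halfBall n)} (hT : T.DivFree) (hTp : T.toMeasure = polyMeasure p q bs ts) :
    ellipticEnvelope ψ b t ≤
        ∑ i, μH[1] (openSegment ℝ (p i) (q i)) * ellipticEnvelope ψ (bs i) (ts i) ∧
      ∑ i, μH[1] (openSegment ℝ (p i) (q i)) * ellipticEnvelope ψ (bs i) (ts i) =
        T.energy (ellipticEnvelope ψ) := by
  have hSm : ∀ i, MeasurableSet (openSegment ℝ (p i) (q i)) := fun i =>
    measurableSet_openSegment (hne i) (hdir i)
  obtain ⟨P, -, hPd, hPe⟩ := exists_polyRep (bs := bs) t hne hdir hΩ hdisj Finset.univ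
  have hPapp : ∀ A, MeasurableSet A → ∫ x in A, P.dens x ∂μH[1] = polyMeasure p q bs ts A := by
    intro A hA
    simp only [polyMeasure_apply hne hdir hA, hPd]
  have hae : ∀ᵐ x ∂μH[1], T.dens x = P.dens x := by
    have := T.dens_ae_eq_of_toMeasure_eq P.integrable_dens MeasurableSet.univ
      fun A _ hA => by rw [hTp, hPapp A hA]
    simpa using this
  have hP : P.DivFree := by
    rw [RectRep.divFree_iff] at hT ⊢
    intro φ h1 h2 h3 i
    rw [← hT φ h1 h2 h3 i]
    refine integral_congr_ae ?_
    filter_upwards [hae] with x hx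
    rw [hx]
  have hPm : P.toMeasure = polyMeasure p q bs ts := by
    ext1 A hA
    rw [P.toMeasure_apply hA, hPapp A hA]
  refine ⟨ellipticEnvelope_le_sum hne hdir hΩ hdisj hP hPd hPe (hPm ▸ hb), ?_⟩
  have h1 : T.energy (ellipticEnvelope ψ) = ∫⁻ x, P.energyDens (ellipticEnvelope ψ) x ∂μH[1] := by
    rw [RectRep.energy_eq_lintegral]
    refine lintegral_congr_ae ?_
    filter_upwards [hae] with x hx
    exact RectRep.energyDens_eq_of_dens_eq (ellipticEnvelope_zero hψ0) ellipticEnvelope_neg_neg hx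
  rw [h1]
  simp only [hPe]
  rw [lintegral_finsetSum _ fun i _ => measurable_const.indicator (hSm i)]
  refine Finset.sum_congr rfl fun i _ => ?_
  rw [lintegral_indicator (hSm i), setLIntegral_const, mul_comm]

theorem homExt_eq {F : UnitSphere n → ℝ} {v : Space n} {t : UnitSphere n}
    (h : v = ‖v‖ • (t : Space n)) : homExt F v = ‖v‖ * F t := by
  by_cases hv : v = 0
  · simp [homExt, hv]
  · rw [homExt, dif_neg hv]
    congr 2
    apply Subtype.ext
    change ‖v‖⁻¹ • v = t
    nth_rewrite 2 [h]
    rw [inv_smul_smul₀ (norm_ne_zero_iff.2 hv)]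

theorem exists_direction {v : Space n} (hv : v ≠ 0) :
    ∃ t : UnitSphere n, v = ‖v‖ • (t : Space n) := by
  refine ⟨⟨‖v‖⁻¹ • v, ?_⟩, ?_⟩
  · simp [norm_smul, inv_mul_cancel₀ (norm_ne_zero_iff.mpr hv)]
  · exact (smul_inv_smul₀ (norm_ne_zero_iff.2 hv) v).symm

/-- Comparison of the cell problem with polygonal networks that satisfy the balance condition
at the vertices. -/
theorem toReal_ellipticEnvelope_le_sum_homExt {N : ℕ} {p q : Fin N → Space n}
    {bs : Fin N → IntLattice m} (hne : ∀ i, p i ≠ q i)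
    (hΩ : ∀ i, openSegment ℝ (p i) (q i) ⊆ halfBall n)
    (hdisj : Pairwise fun i j => Disjoint (openSegment ℝ (p i) (q i)) (openSegment ℝ (p j) (q j)))
    {ts : Fin N → UnitSphere n} (hdir : ∀ i, q i - p i = ‖q i - p i‖ • (ts i : Space n))
    {b : IntLattice m} {t : UnitSphere n}
    (hbal : ∀ (φ : Space n → ℝ), φ ((1 / 2 : ℝ) • (t : Space n)) = 0 →
      φ (-(1 / 2 : ℝ) • (t : Space n)) = 0 → ∀ j,
      ∑ i, (bs i j : ℝ) * (φ (q i) - φ (p i)) = 0)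
    {r : ℝ} (hr : r < 1 / 2) (hbd : ∀ x : Space n, r < ‖x‖ →
      ∑ i, (openSegment ℝ (p i) (q i)).indicator (fun _ => tensor (bs i) (ts i : Space n)) x =
        lineDens b t x) :
    (ellipticEnvelope ψ b t).toReal ≤
      ∑ i, homExt (fun t => (ellipticEnvelope ψ (bs i) t).toReal) (q i - p i) := by
  have hSm : ∀ i, MeasurableSet (openSegment ℝ (p i) (q i)) := fun i =>
    measurableSet_openSegment (hne i) (hdir i)
  obtain ⟨P, -, hPd, hPe⟩ := exists_polyRep (bs := bs) t hne hdir hΩ hdisj Finset.univ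
  have hP : P.DivFree := by
    rw [RectRep.divFree_iff]
    intro φ hφ hc hs j
    have h0 : ∀ s : ℝ, |s| = 1 / 2 → φ (s • (t : Space n)) = 0 := fun s =>
      apply_smul_sphere_eq_zero hs t
    have hseg : ∀ i x, fderiv ℝ φ x ((openSegment ℝ (p i) (q i)).indicator
        (fun _ => tensor (bs i) (ts i : Space n)) x j) =
        (openSegment ℝ (p i) (q i)).indicator
          (fun x => (bs i j : ℝ) * fderiv ℝ φ x (ts i : Space n)) x := by
      intro i x
      by_cases hx : x ∈ openSegment ℝ (p i) (q i) <;> simp [hx]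
    have hint : ∀ i, Integrable (fun x => fderiv ℝ φ x ((openSegment ℝ (p i) (q i)).indicator
        (fun _ => tensor (bs i) (ts i : Space n)) x j)) μH[1] := by
      intro i
      refine integrable_fderiv_apply hφ hc ((integrable_indicator_iff (hSm i)).2
        (integrableOn_const ?_)) j
      rw [hausdorff_openSegment (hne i) (hdir i)]
      exact ENNReal.ofReal_ne_top
    simp only [hPd, Finset.sum_apply, map_sum]
    rw [integral_finsetSum _ fun i _ => hint i]
    -- Each segment contributes its multiplicity times an endpoint difference, so only the vertex
    -- values of `φ` matter.
    rw [← hbal φ (h0 _ (by norm_num)) (h0 _ (by norm_num)) j]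
    refine Finset.sum_congr rfl fun i _ => ?_
    simp only [hseg]
    rw [integral_indicator (hSm i), integral_const_mul,
      setIntegral_fderiv_openSegment (hne i) (hdir i) hφ]
  have hb : HasLineBoundary P.toMeasure b t := by
    refine (hasLineBoundary_toMeasure_iff P b t).2 ⟨r, hr, ae_of_all _ fun x hx => ?_⟩
    rw [mem_closedBall_zero_iff, not_le] at hx
    rw [hPd, hbd x hx]
  have h := ellipticEnvelope_le_sum (ψ := ψ) hne hdir hΩ hdisj hP hPd hPe hb
  have hterm : ∀ i, μH[1] (openSegment ℝ (p i) (q i)) * ellipticEnvelope ψ (bs i) (ts i) ≠ ∞ :=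
    fun i => by
      rw [hausdorff_openSegment (hne i) (hdir i)]
      exact ENNReal.mul_ne_top ENNReal.ofReal_ne_top (ellipticEnvelope_ne_top _ _)
  refine (ENNReal.toReal_mono (ENNReal.sum_ne_top.2 fun i _ => hterm i) h).trans_eq ?_
  rw [ENNReal.toReal_sum fun i _ => hterm i]
  refine Finset.sum_congr rfl fun i _ => ?_
  rw [homExt_eq (hdir i), ENNReal.toReal_mul, hausdorff_openSegment (hne i) (hdir i),
    ENNReal.toReal_ofReal (norm_nonneg _)]

end Polyhedral

/-! ### The line with a triangular detour. -/

section Tooth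
variable {m n : ℕ} {ψ : IntLattice m → UnitSphere n → ℝ≥0}

theorem collinear_dir {a c : ℝ} (h : a < c) (t : UnitSphere n) :
    c • (t : Space n) - a • (t : Space n) =
      ‖c • (t : Space n) - a • (t : Space n)‖ • (t : Space n) := by
  rw [← sub_smul, norm_smul, norm_coe_sphere, mul_one, Real.norm_eq_abs,
    abs_of_pos (sub_pos.2 h)]

theorem coe_sphere_ne_zero (t : UnitSphere n) : (t : Space n) ≠ 0 :=
  norm_ne_zero_iff.1 (by rw [norm_coe_sphere]; exact one_ne_zero)

theorem smul_sphere_ne {a c : ℝ} (h : a < c) (t : UnitSphere n) :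
    a • (t : Space n) ≠ c • (t : Space n) :=
  fun h' => h.ne (smul_left_injective ℝ (coe_sphere_ne_zero t) h')

theorem mem_openSegment_smul {a c : ℝ} (h : a < c) (t : UnitSphere n) {x : Space n} :
    x ∈ openSegment ℝ (a • (t : Space n)) (c • (t : Space n)) ↔
      ∃ s : ℝ, a < s ∧ s < c ∧ x = s • (t : Space n) := by
  have hn : ‖c • (t : Space n) - a • (t : Space n)‖ = c - a := by
    rw [← sub_smul, norm_smul, norm_coe_sphere, mul_one, Real.norm_eq_abs,
      abs_of_pos (sub_pos.2 h)]
  rw [openSegment_eq_image_line (smul_sphere_ne h t) (collinear_dir h t), hn]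
  constructor
  · rintro ⟨s, ⟨h1, h2⟩, rfl⟩
    exact ⟨a + s, by linarith, by linarith, (add_smul _ _ _).symm⟩
  · rintro ⟨s, h1, h2, rfl⟩
    refine ⟨s - a, ⟨by linarith, by linarith⟩, ?_⟩
    simp only [← add_smul, add_sub_cancel]

theorem homExt_smul_sphere {F : UnitSphere n → ℝ} {a : ℝ} (ha : 0 ≤ a) (t : UnitSphere n) :
    homExt F (a • (t : Space n)) = a * F t := by
  have hn : ‖a • (t : Space n)‖ = a := by
    rw [norm_smul, norm_coe_sphere, mul_one, Real.norm_eq_abs, abs_of_nonneg ha]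
  rw [homExt_eq (t := t) (by rw [hn]), hn]

/-- Comparison with the line in which a segment of multiplicity `b + b'` is split into a segment
of multiplicity `b` and a triangular detour of multiplicity `b'`. -/
theorem envelope_detour_le (b b' : IntLattice m) (t : UnitSphere n) {w : Space n}
    (hw : inner ℝ w (t : Space n) = 0) (hw0 : w ≠ 0) (α : ℝ) {ε : ℝ} (hε : 0 < ε)
    (hε2 : ε < 1 / 2) (hp : ‖α • (t : Space n) + w‖ < 1 / 2) :
    2 * ε * (ellipticEnvelope ψ (b + b') t).toReal ≤
      2 * ε * (ellipticEnvelope ψ b t).toReal +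
      (homExt (fun t => (ellipticEnvelope ψ b' t).toReal) ((α + ε) • (t : Space n) + w) +
      homExt (fun t => (ellipticEnvelope ψ b' t).toReal) ((ε - α) • (t : Space n) - w)) := by
  set P : Space n := α • (t : Space n) + w with hP
  have hW : 0 < ‖w‖ ^ 2 := by positivity
  have hww : inner ℝ w w = ‖w‖ ^ 2 := real_inner_self_eq_norm_sq w
  have hwP : inner ℝ w P = ‖w‖ ^ 2 := by
    rw [hP, inner_add_right, inner_smul_right, hw, hww, mul_zero, zero_add]
  have htw : inner ℝ (t : Space n) w = 0 := by rw [real_inner_comm]; exact hw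
  have htt : inner ℝ (t : Space n) (t : Space n) = 1 := by
    rw [real_inner_self_eq_norm_sq, norm_coe_sphere, one_pow]
  have htP : inner ℝ (t : Space n) P = α := by
    rw [hP, inner_add_right, inner_smul_right, htw, htt]; ring
  have hvec3 : P - (-ε) • (t : Space n) = (α + ε) • (t : Space n) + w := by
    rw [hP, add_smul, neg_smul]; abel
  have hvec4 : ε • (t : Space n) - P = (ε - α) • (t : Space n) - w := by
    rw [hP, sub_smul]; abel
  have hPne : ∀ a : ℝ, P ≠ a • (t : Space n) := by
    intro a h
    have := hwP
    rw [h, inner_smul_right, hw, mul_zero] at this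
    exact hW.ne this
  obtain ⟨t₃, ht₃⟩ := exists_direction (sub_ne_zero.2 (hPne (-ε)))
  obtain ⟨t₄, ht₄⟩ := exists_direction (sub_ne_zero.2 (hPne ε).symm)
  have h01 : -(1 / 2 : ℝ) < -ε := by linarith
  have h12 : -ε < ε := by linarith
  -- Disjointness is read off from two coordinates: `⟨w, ·⟩` vanishes on the line and is positive on
  -- the open sides of the triangle, and `⟨t, ·⟩` separates the segments of the line.
  have hcol : ∀ {a c : ℝ}, a < c → ∀ x ∈ openSegment ℝ (a • (t : Space n)) (c • (t : Space n)),
      inner ℝ w x = 0 ∧ a < inner ℝ (t : Space n) x ∧ inner ℝ (t : Space n) x < c := by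
    intro a c hac x hx
    obtain ⟨s, h1, h2, rfl⟩ := (mem_openSegment_smul hac t).1 hx
    rw [inner_smul_right, inner_smul_right, hw, htt, mul_zero, mul_one]
    exact ⟨rfl, h1, h2⟩
  have hup3 : ∀ x ∈ openSegment ℝ ((-ε) • (t : Space n)) P, ∃ β : ℝ, 0 < β ∧ β < 1 ∧
      inner ℝ w x = β * ‖w‖ ^ 2 ∧ inner ℝ (t : Space n) x = -(1 - β) * ε + β * α := by
    rintro x ⟨a, β, ha, hβ, hab, rfl⟩
    refine ⟨β, hβ, by linarith, ?_, ?_⟩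
    · rw [inner_add_right, inner_smul_right, inner_smul_right, inner_smul_right, hw, hwP]; ring
    · have hab1 : a = 1 - β := by linarith
      rw [inner_add_right, inner_smul_right, inner_smul_right, inner_smul_right, htt, htP, hab1]
      ring
  have hup4 : ∀ x ∈ openSegment ℝ P (ε • (t : Space n)), ∃ β : ℝ, 0 < β ∧ β < 1 ∧
      inner ℝ w x = β * ‖w‖ ^ 2 ∧ inner ℝ (t : Space n) x = (1 - β) * ε + β * α := by
    rintro x ⟨β, a, hβ, ha, hab, rfl⟩
    refine ⟨β, hβ, by linarith, ?_, ?_⟩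
    · rw [inner_add_right, inner_smul_right, inner_smul_right, inner_smul_right, hw, hwP]; ring
    · have hab1 : a = 1 - β := by linarith
      rw [inner_add_right, inner_smul_right, inner_smul_right, inner_smul_right, htt, htP, hab1]
      ring
  have d01 : Disjoint (openSegment ℝ (-(1 / 2 : ℝ) • (t : Space n)) ((-ε) • (t : Space n)))
      (openSegment ℝ ((-ε) • (t : Space n)) (ε • (t : Space n))) := disjoint_left.2 fun x hx hy =>
    by linarith [(hcol h01 x hx).2.2, (hcol h12 x hy).2.1]
  have d04 : Disjoint (openSegment ℝ (-(1 / 2 : ℝ) • (t : Space n)) ((-ε) • (t : Space n)))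
      (openSegment ℝ (ε • (t : Space n)) ((1 / 2 : ℝ) • (t : Space n))) :=
    disjoint_left.2 fun x hx hy => by linarith [(hcol h01 x hx).2.2, (hcol hε2 x hy).2.1]
  have d14 : Disjoint (openSegment ℝ ((-ε) • (t : Space n)) (ε • (t : Space n)))
      (openSegment ℝ (ε • (t : Space n)) ((1 / 2 : ℝ) • (t : Space n))) :=
    disjoint_left.2 fun x hx hy => by linarith [(hcol h12 x hx).2.2, (hcol hε2 x hy).2.1]
  have hd3 : ∀ {a c : ℝ}, a < c → Disjoint (openSegment ℝ (a • (t : Space n)) (c • (t : Space n)))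
      (openSegment ℝ ((-ε) • (t : Space n)) P) := fun hac => disjoint_left.2 fun x hx hy => by
    obtain ⟨β, h1, -, h2, -⟩ := hup3 x hy
    rw [(hcol hac x hx).1] at h2
    exact (mul_pos h1 hW).ne h2
  have hd4 : ∀ {a c : ℝ}, a < c → Disjoint (openSegment ℝ (a • (t : Space n)) (c • (t : Space n)))
      (openSegment ℝ P (ε • (t : Space n))) := fun hac => disjoint_left.2 fun x hx hy => by
    obtain ⟨β, h1, -, h2, -⟩ := hup4 x hy
    rw [(hcol hac x hx).1] at h2
    exact (mul_pos h1 hW).ne h2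
  have d23 : Disjoint (openSegment ℝ ((-ε) • (t : Space n)) P)
      (openSegment ℝ P (ε • (t : Space n))) := disjoint_left.2 fun x hx hy => by
    obtain ⟨β, -, h1, h2, h3⟩ := hup3 x hx
    obtain ⟨β', -, -, h2', h3'⟩ := hup4 x hy
    have hβ : β = β' := mul_right_cancel₀ hW.ne' (h2.symm.trans h2')
    subst hβ
    rw [h3] at h3'
    nlinarith
  have hnorm : ∀ a : ℝ, ‖a • (t : Space n)‖ = |a| := fun a => by
    rw [norm_smul, norm_coe_sphere, mul_one, Real.norm_eq_abs]
  have hballcol : ∀ {a c : ℝ}, -(1 / 2 : ℝ) ≤ a → c ≤ 1 / 2 → a < c →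
      openSegment ℝ (a • (t : Space n)) (c • (t : Space n)) ⊆ halfBall n := by
    intro a c ha hc hac x hx
    obtain ⟨s, h1, h2, rfl⟩ := (mem_openSegment_smul hac t).1 hx
    rw [mem_ball_zero_iff, hnorm, abs_lt]
    exact ⟨by linarith, by linarith⟩
  -- This closed ball contains the triangle, so outside it only the two outer segments of the line
  -- remain.
  set r := max ε ‖P‖ with hr
  have hr2 : r < 1 / 2 := max_lt hε2 hp
  have hmemP : P ∈ Metric.closedBall (0 : Space n) r :=
    mem_closedBall_zero_iff.2 (le_max_right _ _)
  have hmeme : ε • (t : Space n) ∈ Metric.closedBall (0 : Space n) r := by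
    rw [mem_closedBall_zero_iff, hnorm, abs_of_pos hε]; exact le_max_left _ _
  have hmemn : (-ε) • (t : Space n) ∈ Metric.closedBall (0 : Space n) r := by
    rw [mem_closedBall_zero_iff, hnorm, abs_neg, abs_of_pos hε]; exact le_max_left _ _
  have hsub : ∀ {y z : Space n}, y ∈ Metric.closedBall (0 : Space n) r →
      z ∈ Metric.closedBall (0 : Space n) r → openSegment ℝ y z ⊆ Metric.closedBall 0 r :=
    fun hy hz => (convex_closedBall _ _).openSegment_subset hy hz
  have hcb : Metric.closedBall (0 : Space n) r ⊆ halfBall n := Metric.closedBall_subset_ball hr2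
  have key := toReal_ellipticEnvelope_le_sum_homExt (ψ := ψ) (b := b + b') (t := t) (r := r)
    (p := ![-(1 / 2 : ℝ) • (t : Space n), (-ε) • (t : Space n), (-ε) • (t : Space n), P,
      ε • (t : Space n)])
    (q := ![(-ε) • (t : Space n), ε • (t : Space n), P, ε • (t : Space n),
      (1 / 2 : ℝ) • (t : Space n)])
    (bs := ![b + b', b, b', b', b + b']) (ts := ![t, t, t₃, t₄, t])
    (by
      intro i
      fin_cases i
      · exact smul_sphere_ne h01 t
      · exact smul_sphere_ne h12 t
      · exact (hPne _).symm
      · exact hPne _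
      · exact smul_sphere_ne hε2 t)
    (by
      intro i
      fin_cases i
      · exact hballcol le_rfl (by linarith) h01
      · exact hballcol (by linarith) (by linarith) h12
      · exact (hsub hmemn hmemP).trans hcb
      · exact (hsub hmemP hmeme).trans hcb
      · exact hballcol (by linarith) le_rfl hε2)
    (by
      intro i j hij
      fin_cases i <;> fin_cases j
      · exact absurd rfl hij
      · exact d01
      · exact hd3 h01
      · exact hd4 h01
      · exact d04
      · exact d01.symm
      · exact absurd rfl hij
      · exact hd3 h12
      · exact hd4 h12
      · exact d14
      · exact (hd3 h01).symm
      · exact (hd3 h12).symm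
      · exact absurd rfl hij
      · exact d23
      · exact (hd3 hε2).symm
      · exact (hd4 h01).symm
      · exact (hd4 h12).symm
      · exact d23.symm
      · exact absurd rfl hij
      · exact (hd4 hε2).symm
      · exact d04.symm
      · exact d14.symm
      · exact hd3 hε2
      · exact hd4 hε2
      · exact absurd rfl hij)
    (by
      intro i
      fin_cases i
      · exact collinear_dir h01 t
      · exact collinear_dir h12 t
      · exact ht₃
      · exact ht₄
      · exact collinear_dir hε2 t)
    (by
      intro φ h1 h2 j
      rw [Fin.sum_univ_five]
      simp only [Matrix.cons_val]
      rw [h1, h2]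
      simp only [Pi.add_apply, Int.cast_add]
      ring)
    hr2
    (by
      intro x hx
      have hxr : x ∉ Metric.closedBall (0 : Space n) r := fun h =>
        not_le.2 hx (mem_closedBall_zero_iff.1 h)
      rw [Fin.sum_univ_five]
      simp only [Matrix.cons_val]
      rw [indicator_of_notMem fun h => hxr (hsub hmemn hmeme h),
        indicator_of_notMem fun h => hxr (hsub hmemn hmemP h),
        indicator_of_notMem fun h => hxr (hsub hmemP hmeme h), add_zero, add_zero, add_zero,
        lineDens]
      by_cases hxd : x ∈ diameter t
      · obtain ⟨s, hs, rfl⟩ := mem_diameter.1 hxd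
        rw [abs_lt] at hs
        rw [hnorm] at hx
        have hεs : ε < |s| := (le_max_left _ _).trans_lt hx
        rw [indicator_of_mem hxd]
        rcases lt_abs.1 hεs with h | h
        · have hm := (mem_openSegment_smul hε2 t).2 ⟨s, h, hs.2, rfl⟩
          rw [indicator_of_mem hm, indicator_of_notMem (d04.notMem_of_mem_right hm), zero_add]
        · have hm := (mem_openSegment_smul h01 t).2 ⟨s, hs.1, by linarith, rfl⟩
          rw [indicator_of_mem hm, indicator_of_notMem (d04.notMem_of_mem_left hm), add_zero]
      · rw [indicator_of_notMem hxd, indicator_of_notMem, indicator_of_notMem, add_zero]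
        · intro h
          obtain ⟨s, h1, h2, rfl⟩ := (mem_openSegment_smul hε2 t).1 h
          exact hxd (mem_diameter.2 ⟨s, abs_lt.2 ⟨by linarith, h2⟩, rfl⟩)
        · intro h
          obtain ⟨s, h1, h2, rfl⟩ := (mem_openSegment_smul h01 t).1 h
          exact hxd (mem_diameter.2 ⟨s, abs_lt.2 ⟨h1, by linarith⟩, rfl⟩))
  -- The outer segments, of total length `1 - 2 ε`, carry `b + b'`; their cost cancels against the
  -- left side and leaves the factor `2 ε`.
  rw [Fin.sum_univ_five] at key
  simp only [Matrix.cons_val] at key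
  rw [hvec3, hvec4, ← sub_smul, ← sub_smul, ← sub_smul, homExt_smul_sphere (by linarith),
    homExt_smul_sphere (by linarith), homExt_smul_sphere (by linarith)] at key
  linarith

end Tooth

/-! ### Convexity, subadditivity, growth and continuity. -/

section Properties
variable {m n : ℕ} {ψ : IntLattice m → UnitSphere n → ℝ≥0}

@[simp] theorem homExt_zero (F : UnitSphere n → ℝ) : homExt F 0 = 0 := by simp [homExt]

theorem homExt_nonneg {F : UnitSphere n → ℝ} (hF : ∀ t, 0 ≤ F t) (v : Space n) :
    0 ≤ homExt F v := by
  by_cases hv : v = 0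
  · simp [hv]
  · obtain ⟨t, ht⟩ := exists_direction hv
    rw [homExt_eq ht]
    exact mul_nonneg (norm_nonneg _) (hF t)

theorem homExt_smul (F : UnitSphere n → ℝ) {a : ℝ} (ha : 0 ≤ a) (v : Space n) :
    homExt F (a • v) = a * homExt F v := by
  by_cases hv : v = 0
  · simp [hv]
  · obtain ⟨t, ht⟩ := exists_direction hv
    rw [homExt_eq ht, ht, smul_smul, homExt_smul_sphere (by positivity), norm_smul, norm_norm,
      norm_coe_sphere]
    ring

@[simp] theorem homExt_coe (F : UnitSphere n → ℝ) (t : UnitSphere n) :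
    homExt F (t : Space n) = F t := by
  have := homExt_smul_sphere (F := F) zero_le_one t
  rwa [one_smul, one_mul] at this

/-- A detour over a base of multiplicity `0`: the triangle with sides `x`, `y` and base `x + y`,
shrunk to fit into `B_{1/2}`. Homogeneity removes the shrinking factor. -/
theorem homExt_envelope_add_le (h0 : ∀ t, ψ 0 t = 0) (b : IntLattice m) (x y : Space n) :
    homExt (fun t => (ellipticEnvelope ψ b t).toReal) (x + y) ≤
      homExt (fun t => (ellipticEnvelope ψ b t).toReal) x +
        homExt (fun t => (ellipticEnvelope ψ b t).toReal) y := by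
  set F : UnitSphere n → ℝ := fun t => (ellipticEnvelope ψ b t).toReal with hF
  have hF0 : ∀ t, 0 ≤ F t := fun t => ENNReal.toReal_nonneg
  by_cases hz : x + y = 0
  · rw [hz, homExt_zero]
    exact add_nonneg (homExt_nonneg hF0 x) (homExt_nonneg hF0 y)
  obtain ⟨t, ht⟩ := exists_direction hz
  have hzpos : 0 < ‖x + y‖ := norm_pos_iff.2 hz
  have htt : inner ℝ (t : Space n) (t : Space n) = 1 := by
    rw [real_inner_self_eq_norm_sq, norm_coe_sphere, one_pow]
  set α : ℝ := inner ℝ (t : Space n) x with hα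
  set w : Space n := x - α • (t : Space n) with hw
  have hx : x = α • (t : Space n) + w := by rw [hw]; abel
  have hy : y = (‖x + y‖ - α) • (t : Space n) - w := by
    rw [sub_smul, ← ht, hw]; abel
  have hwt : inner ℝ w (t : Space n) = 0 := by
    rw [hw, inner_sub_left, inner_smul_left, htt, real_inner_comm, ← hα]; simp
  rw [homExt_eq ht]
  by_cases hw0 : w = 0
  · have hge : ∀ a : ℝ, a * F t ≤ homExt F (a • (t : Space n)) := by
      intro a
      rcases le_or_gt 0 a with ha | ha
      · rw [homExt_smul_sphere ha]
      · exact (mul_nonpos_of_nonpos_of_nonneg ha.le (hF0 t)).trans (homExt_nonneg hF0 _)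
    have h1 := hge α
    have h2 := hge (‖x + y‖ - α)
    rw [hw0, add_zero] at hx
    rw [hw0, sub_zero] at hy
    rw [← hx] at h1
    rw [← hy] at h2
    linarith
  · set M : ℝ := ‖x + y‖ + ‖(α - ‖x + y‖ / 2) • (t : Space n) + w‖ + 1 with hM
    have hMpos : 0 < M := by positivity
    set l : ℝ := 1 / (2 * M) with hl
    have hlpos : 0 < l := by positivity
    have hlM : l * M = 1 / 2 := by rw [hl]; field_simp
    have h := envelope_detour_le (ψ := ψ) 0 b t (w := l • w)
      (by rw [inner_smul_left, hwt, mul_zero]) (smul_ne_zero hlpos.ne' hw0)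
      (l * (α - ‖x + y‖ / 2)) (ε := l * (‖x + y‖ / 2)) (by positivity)
      (by
        rw [← hlM]
        refine mul_lt_mul_of_pos_left ?_ hlpos
        have := norm_nonneg ((α - ‖x + y‖ / 2) • (t : Space n) + w)
        linarith)
      (by
        rw [mul_smul, ← smul_add, norm_smul, Real.norm_eq_abs, abs_of_pos hlpos, ← hlM]
        refine mul_lt_mul_of_pos_left ?_ hlpos
        linarith)
    have e1 : (l * (α - ‖x + y‖ / 2) + l * (‖x + y‖ / 2)) • (t : Space n) + l • w = l • x := by
      rw [← mul_add, sub_add_cancel, mul_smul, ← smul_add, ← hx]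
    have e2 : (l * (‖x + y‖ / 2) - l * (α - ‖x + y‖ / 2)) • (t : Space n) - l • w = l • y := by
      rw [← mul_sub, mul_smul, ← smul_sub,
        show ‖x + y‖ / 2 - (α - ‖x + y‖ / 2) = ‖x + y‖ - α by ring, ← hy]
    rw [e1, e2, homExt_smul _ hlpos.le, homExt_smul _ hlpos.le, zero_add,
      ellipticEnvelope_zero h0, ENNReal.toReal_zero, mul_zero, zero_add] at h
    have h' : l * (‖x + y‖ * F t) ≤ l * (homExt F x + homExt F y) := by
      calc l * (‖x + y‖ * F t) = 2 * (l * (‖x + y‖ / 2)) * F t := by ring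
        _ ≤ _ := h
        _ = _ := by ring
    exact le_of_mul_le_mul_left h' hlpos

theorem convexOn_homExt_envelope (h0 : ∀ t, ψ 0 t = 0) (b : IntLattice m) :
    ConvexOn ℝ univ (homExt fun t => (ellipticEnvelope ψ b t).toReal) := by
  refine ⟨convex_univ, fun x _ y _ a c ha hc _ => ?_⟩
  refine (homExt_envelope_add_le h0 b _ _).trans_eq ?_
  rw [homExt_smul _ ha, homExt_smul _ hc, smul_eq_mul, smul_eq_mul]

/-- The room for a detour: this is where dimension at least two enters. -/
theorem exists_orthogonal (hn : 2 ≤ n) (t : UnitSphere n) :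
    ∃ s : Space n, s ≠ 0 ∧ inner ℝ s (t : Space n) = 0 := by
  have hne : (Submodule.span ℝ {(t : Space n)})ᗮ ≠ ⊥ := by
    intro h
    rw [Submodule.orthogonal_eq_bot_iff] at h
    have h1 := finrank_span_singleton (K := ℝ) (coe_sphere_ne_zero t)
    rw [h, finrank_top, finrank_euclideanSpace_fin] at h1
    omega
  obtain ⟨s, hs, hs0⟩ := Submodule.exists_mem_ne_zero_of_ne_bot hne
  refine ⟨s, hs0, ?_⟩
  rw [real_inner_comm]
  exact Submodule.mem_orthogonal_singleton_iff_inner_right.1 hs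

/-- Two copies of the line cannot overlap, so the `b'` part is lifted over `[-1/4, 1/4]` to a small
height `δ`. Subadditivity in the direction bounds the cost of tilting by a multiple of `δ`, without
prior knowledge of continuity. -/
theorem envelope_add_le (hn : 2 ≤ n) (h0 : ∀ t, ψ 0 t = 0) (b b' : IntLattice m)
    (t : UnitSphere n) : (ellipticEnvelope ψ (b + b') t).toReal ≤
      (ellipticEnvelope ψ b t).toReal + (ellipticEnvelope ψ b' t).toReal := by
  obtain ⟨s, hs0, hst⟩ := exists_orthogonal hn t
  set G := homExt fun t => (ellipticEnvelope ψ b' t).toReal with hG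
  have hGnn : ∀ v, 0 ≤ G v := homExt_nonneg fun _ => ENNReal.toReal_nonneg
  set K : ℝ := G s + G (-s) with hK
  have hKnn : 0 ≤ K := add_nonneg (hGnn _) (hGnn _)
  refine le_of_forall_pos_le_add fun η hη => ?_
  -- The first bound keeps the apex in the ball. The second leaves an error `η / 2`, which becomes
  -- `η` after division by the base length `1 / 2`.
  set δ : ℝ := min (1 / (4 * ‖s‖)) (η / (2 * (K + 1))) with hδ
  have hspos : 0 < ‖s‖ := norm_pos_iff.2 hs0
  have hδpos : 0 < δ := lt_min (by positivity) (by positivity)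
  have hδs : δ * ‖s‖ ≤ 1 / 4 := by
    calc δ * ‖s‖ ≤ 1 / (4 * ‖s‖) * ‖s‖ := by gcongr; exact min_le_left _ _
      _ = 1 / 4 := by field_simp
  have hδK : δ * K ≤ η / 2 := by
    calc δ * K ≤ η / (2 * (K + 1)) * (K + 1) := by
          gcongr
          · exact min_le_right _ _
          · linarith
      _ = η / 2 := by field_simp
  have h := envelope_detour_le (ψ := ψ) b b' t (w := δ • s)
    (by rw [inner_smul_left, hst, mul_zero]) (smul_ne_zero hδpos.ne' hs0) 0 (ε := 1 / 4)
    (by norm_num) (by norm_num)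
    (by
      rw [zero_smul, zero_add, norm_smul, Real.norm_eq_abs, abs_of_pos hδpos]
      linarith)
  have h1 := homExt_envelope_add_le h0 b' ((0 + 1 / 4 : ℝ) • (t : Space n)) (δ • s)
  have h2 := homExt_envelope_add_le h0 b' ((1 / 4 - 0 : ℝ) • (t : Space n)) (δ • (-s))
  rw [homExt_smul_sphere (by norm_num), homExt_smul _ hδpos.le, ← hG] at h1 h2
  rw [smul_neg, ← sub_eq_add_neg] at h2
  rw [← hG] at h
  have h3 : δ * G s + δ * G (-s) ≤ η / 2 := by rw [← mul_add]; exact hδK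
  linarith

/-- `ψ` need not be bounded in `t`; subadditivity reduces all directions to the finitely many `± e
j`, as the coordinates of `t` are at most `1` in modulus. -/
theorem exists_homExt_envelope_le (h0 : ∀ t, ψ 0 t = 0) (b : IntLattice m) :
    ∃ C : ℝ, 0 ≤ C ∧ ∀ t : UnitSphere n, (ellipticEnvelope ψ b t).toReal ≤ C := by
  set G := homExt fun t : UnitSphere n => (ellipticEnvelope ψ b t).toReal with hG
  have hGnn : ∀ v, 0 ≤ G v := homExt_nonneg fun _ => ENNReal.toReal_nonneg
  set e : Fin n → Space n := fun j => EuclideanSpace.single j (1 : ℝ) with he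
  refine ⟨∑ j, (G (e j) + G (-e j)), Finset.sum_nonneg fun j _ =>
    add_nonneg (hGnn _) (hGnn _), fun t => ?_⟩
  have hsum : ∀ (s : Finset (Fin n)) (v : Fin n → Space n), G (∑ j ∈ s, v j) ≤ ∑ j ∈ s, G (v j) :=
    fun s v => Finset.le_sum_of_subadditive G (homExt_zero _).le (homExt_envelope_add_le h0 b) s v
  have ht : (t : Space n) = ∑ j, (t : Space n) j • e j := by
    ext k
    simp [he, Finset.sum_apply, Pi.single_apply]
  calc (ellipticEnvelope ψ b t).toReal = G t := by rw [hG, homExt_coe]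
    _ ≤ ∑ j, G ((t : Space n) j • e j) := by
        conv_lhs => rw [ht]
        exact hsum _ _
    _ ≤ _ := by
        refine Finset.sum_le_sum fun j _ => ?_
        have habs : |(t : Space n) j| ≤ 1 := by
          have := PiLp.norm_apply_le (t : Space n) j
          rwa [norm_coe_sphere, Real.norm_eq_abs] at this
        rw [abs_le] at habs
        have h1 := hGnn (e j)
        have h2 := hGnn (-e j)
        rcases le_total 0 ((t : Space n) j) with h | h
        · rw [hG, homExt_smul _ h, ← hG]
          nlinarith
        · rw [← neg_neg ((t : Space n) j), neg_smul, ← smul_neg, hG,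
            homExt_smul _ (neg_nonneg.2 h), ← hG]
          nlinarith

/-- The envelope has linear growth in the multiplicity, uniformly in the direction. -/
theorem exists_envelope_le_latticeNorm (hn : 2 ≤ n) (h0 : ∀ t, ψ 0 t = 0) :
    ∃ C : ℝ, 0 ≤ C ∧ ∀ b t, (ellipticEnvelope ψ b t).toReal ≤ C * latticeNorm b := by
  choose C hC0 hC using exists_homExt_envelope_le (ψ := ψ) h0
  -- Subadditivity in the multiplicity reduces everything to `± e i`, so finitely many of the bounds
  -- `C` suffice.
  set e : Fin m → IntLattice m := fun i => Pi.single i 1 with he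
  refine ⟨∑ i, (C (e i) + C (-e i)), Finset.sum_nonneg fun i _ => add_nonneg (hC0 _) (hC0 _),
    fun b t => ?_⟩
  set E : IntLattice m → ℝ := fun b => (ellipticEnvelope ψ b t).toReal with hE
  have hEz : E 0 = 0 := by simp [hE, ellipticEnvelope_zero h0]
  have hadd : ∀ x y, E (x + y) ≤ E x + E y := fun x y => envelope_add_le hn h0 x y t
  have hnsmul : ∀ (k : ℕ) x, E (k • x) ≤ k * E x := by
    intro k x
    induction k with
    | zero => simp [hEz]
    | succ k ih =>
      rw [succ_nsmul]
      refine (hadd _ _).trans ?_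
      push_cast
      linarith
  have hzsmul : ∀ (z : ℤ) i, E (z • e i) ≤ |(z : ℝ)| * (C (e i) + C (-e i)) := by
    intro z i
    have h1 := hC (e i) t
    have h2 := hC (-e i) t
    obtain ⟨k, rfl | rfl⟩ := z.eq_nat_or_neg
    · rw [natCast_zsmul]
      refine (hnsmul k (e i)).trans ?_
      rw [Int.cast_natCast, Nat.abs_cast]
      gcongr
      linarith [hC0 (-e i)]
    · rw [neg_smul, natCast_zsmul, ← smul_neg]
      refine (hnsmul k (-e i)).trans ?_
      rw [Int.cast_neg, abs_neg, Int.cast_natCast, Nat.abs_cast]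
      gcongr
      linarith [hC0 (e i)]
  have hb : b = ∑ i, b i • e i := by
    ext k
    simp [he, Finset.sum_apply, Pi.single_apply]
  calc E b ≤ ∑ i, E (b i • e i) := by
        conv_lhs => rw [hb]
        exact Finset.le_sum_of_subadditive E hEz.le hadd _ _
    _ ≤ ∑ i, latticeNorm b * (C (e i) + C (-e i)) := by
        refine Finset.sum_le_sum fun i _ => (hzsmul _ _).trans ?_
        gcongr
        · exact add_nonneg (hC0 _) (hC0 _)
        · exact abs_le_latticeNorm b i
    _ = _ := by rw [← Finset.mul_sum, mul_comm]

theorem latticeNorm_sub_comm (b b' : IntLattice m) :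
    latticeNorm (b - b') = latticeNorm (b' - b) := by
  unfold latticeNorm
  congr 1
  refine Finset.sum_congr rfl fun i _ => ?_
  simp only [Pi.sub_apply, Int.cast_sub]
  ring

/-- Subadditivity applied to an increment, whose cost is bounded by linear growth. The direction is
changed first, at multiplicity `b`, and then the multiplicity, at direction `t'`. -/
theorem abs_envelope_sub_le (hn : 2 ≤ n) (h0 : ∀ t, ψ 0 t = 0) {C : ℝ}
    (hC : ∀ b t, (ellipticEnvelope ψ b t).toReal ≤ C * latticeNorm b) (b b' : IntLattice m)
    (t t' : UnitSphere n) :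
    |(ellipticEnvelope ψ b t).toReal - (ellipticEnvelope ψ b' t').toReal| ≤
      C * latticeNorm (b - b') + C * latticeNorm b * ‖(t : Space n) - (t' : Space n)‖ := by
  have hdir : ∀ u v : UnitSphere n, (ellipticEnvelope ψ b u).toReal ≤
      (ellipticEnvelope ψ b v).toReal + C * latticeNorm b * ‖(u : Space n) - (v : Space n)‖ := by
    intro u v
    have h := homExt_envelope_add_le h0 b (v : Space n) ((u : Space n) - v)
    rw [add_sub_cancel, homExt_coe, homExt_coe] at h
    refine h.trans ?_
    gcongr
    by_cases huv : (u : Space n) - v = 0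
    · simp [huv]
    · obtain ⟨s, hs⟩ := exists_direction huv
      rw [homExt_eq hs, mul_comm]
      gcongr
      exact hC b s
  have hmult : ∀ x y : IntLattice m, (ellipticEnvelope ψ x t').toReal ≤
      (ellipticEnvelope ψ y t').toReal + C * latticeNorm (x - y) := by
    intro x y
    have h := envelope_add_le hn h0 y (x - y) t'
    rw [add_sub_cancel] at h
    exact h.trans (by gcongr; exact hC _ _)
  have h1 := hdir t t'
  have h2 := hdir t' t
  have h3 := hmult b b'
  have h4 := hmult b' b
  rw [norm_sub_rev] at h2
  rw [latticeNorm_sub_comm b' b] at h4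
  rw [abs_le]
  constructor <;> linarith

/-- The lattice is discrete, so the Lipschitz bound in `t` at fixed `b` suffices. -/
theorem continuous_envelope (hn : 2 ≤ n) (h0 : ∀ t, ψ 0 t = 0) {C : ℝ} (hC0 : 0 ≤ C)
    (hC : ∀ b t, (ellipticEnvelope ψ b t).toReal ≤ C * latticeNorm b) :
    Continuous fun z : IntLattice m × UnitSphere n => (ellipticEnvelope ψ z.1 z.2).toReal := by
  rw [continuous_prod_of_discrete_left]
  intro b
  refine (LipschitzWith.of_dist_le_mul (K := ⟨C * latticeNorm b,
    mul_nonneg hC0 (latticeNorm_nonneg b)⟩) fun t t' => ?_).continuous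
  have h := abs_envelope_sub_le hn h0 hC b b t t'
  rw [sub_self, latticeNorm_zero, mul_zero, zero_add] at h
  rw [Real.dist_eq, Subtype.dist_eq, dist_eq_norm]
  exact h

end Properties

theorem lemma3p2 {m n : ℕ} (hn : 2 ≤ n)
    (ψ : IntLattice m → UnitSphere n → ℝ≥0)
    (hψ_meas : Measurable (fun z : IntLattice m × UnitSphere n => ψ z.1 z.2))
    (c₀ : ℝ) (hc₀ : 0 < c₀)
    (hψ_lower : ∀ b t, c₀ * latticeNorm b ≤ (ψ b t : ℝ))
    (hψ_zero : ∀ t, ψ 0 t = 0) :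
    -- the envelope is finite
    (∀ b t, ellipticEnvelope ψ b t ≠ ∞) ∧
    -- comparison with polyhedral competitors; the middle sum is the relaxed energy
    -- of the polyhedral measure, whatever representation `T` of the measure is used
    (∀ (b : IntLattice m) (t : UnitSphere n) (N : ℕ) (p q : Fin N → Space n)
      (bs : Fin N → IntLattice m) (ts : Fin N → UnitSphere n),
      (∀ i, p i ≠ q i) →
      (∀ i, q i - p i = ‖q i - p i‖ • (ts i : Space n)) →
      (∀ i, openSegment ℝ (p i) (q i) ⊆ halfBall n) →
      Pairwise (fun i j => Disjoint (openSegment ℝ (p i) (q i)) (openSegment ℝ (p j) (q j))) →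
      HasLineBoundary (polyMeasure p q bs ts) b t →
      ∀ T : RectRep m n (halfBall n), T.DivFree → T.toMeasure = polyMeasure p q bs ts →
        ellipticEnvelope ψ b t ≤
            ∑ i, Measure.hausdorffMeasure 1 (openSegment ℝ (p i) (q i)) *
              ellipticEnvelope ψ (bs i) (ts i) ∧
          ∑ i, Measure.hausdorffMeasure 1 (openSegment ℝ (p i) (q i)) *
              ellipticEnvelope ψ (bs i) (ts i) = T.energy (ellipticEnvelope ψ)) ∧
    -- convexity of the one-homogeneous extension, and continuity
    (∀ b, ConvexOn ℝ Set.univ (homExt fun t => (ellipticEnvelope ψ b t).toReal)) ∧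
    Continuous (fun z : IntLattice m × UnitSphere n => (ellipticEnvelope ψ z.1 z.2).toReal) ∧
    -- subadditivity in the first argument
    (∀ b b' t, (ellipticEnvelope ψ (b + b') t).toReal ≤
      (ellipticEnvelope ψ b t).toReal + (ellipticEnvelope ψ b' t).toReal) ∧
    -- linear growth and Lipschitz continuity, with one constant depending only on `ψ`
    (∃ c : ℝ, 0 < c ∧
      (∀ b t, 1 / c * latticeNorm b ≤ (ellipticEnvelope ψ b t).toReal ∧
        (ellipticEnvelope ψ b t).toReal ≤ c * latticeNorm b) ∧
      (∀ b b' t t',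
        |(ellipticEnvelope ψ b t).toReal - (ellipticEnvelope ψ b' t').toReal| ≤
          c * latticeNorm (b - b') +
            c * latticeNorm b * ‖(t : Space n) - (t' : Space n)‖)) := by
  obtain ⟨C, hC0, hC⟩ := exists_envelope_le_latticeNorm hn hψ_zero
  -- `C + 1 / c₀` dominates `C`, and its inverse is at most `c₀`; it is positive even when `C = 0`.
  refine ⟨ellipticEnvelope_ne_top, ?_, convexOn_homExt_envelope hψ_zero,
    continuous_envelope hn hψ_zero hC0 hC, envelope_add_le hn hψ_zero, C + 1 / c₀, by positivity,
    fun b t => ⟨?_, ?_⟩, ?_⟩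
  · intro b t N p q bs ts hne hdir hΩ hdisj hb T hT hTp
    exact ellipticEnvelope_le_sum_and_sum_eq_energy hψ_zero hne hdir hΩ hdisj hb hT hTp
  · have h := ENNReal.toReal_mono (ellipticEnvelope_ne_top b t)
      (ofReal_le_ellipticEnvelope hc₀ hψ_lower b t)
    rw [ENNReal.toReal_ofReal (mul_nonneg hc₀.le (latticeNorm_nonneg b))] at h
    refine (mul_le_mul_of_nonneg_right ?_ (latticeNorm_nonneg b)).trans h
    rw [div_le_iff₀ (by positivity), mul_add, mul_one_div_cancel hc₀.ne']
    linarith [mul_nonneg hc₀.le hC0]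
  · refine (hC b t).trans (mul_le_mul_of_nonneg_right ?_ (latticeNorm_nonneg b))
    linarith [one_div_pos.2 hc₀]
  · refine abs_envelope_sub_le hn hψ_zero fun b t => ?_
    refine (hC b t).trans (mul_le_mul_of_nonneg_right ?_ (latticeNorm_nonneg b))
    linarith [one_div_pos.2 hc₀]
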